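/- Let $p$ be a prime, $G=C_{p^2}$ the cyclic group of order $p^2$ with generator $x$, $e$ its trivial subgroup and $C_p$ its subgroup of order $p$. **Definitions.** Let $A\le G$. An $A$-weak indexing system $\underline{\mathbb F}$ assigns to each subgroup $H\le A$ a class $\mathbb F_H$ of finite $H$-sets, closed under isomorphism and under restriction (and conjugation), such that $*_H\in\mathbb F_H$ whenever $\mathbb F_H\ne\emptyset$, and closed under self-indexed coproducts: if $\coprod_i[H/K_i]\in\mathbb F_H$ and $T_i\in\mathbb F_{K_i}$ for all $i$ (a finite index set), then $\coprod_i\mathrm{Ind}_{K_i}^H T_i\in\mathbb F_H$. It is *unital* if every $\mathbb F_H$ is nonempty and $S\sqcup S'\in\mathbb F_H$ implies $S,S'\in\mathbb F_H$. Weak indexing systems are ordered by inclusion; $\vee$ is the join in this lattice. For a unital $\underline{\mathbb F}$, its transfer system is $\{K\le H: [H/K]\in\mathbb F_H\}$ and its fold family is $\{H: 2\cdot *_H\in\mathbb F_H\}$. Write $\underline{\mathbb F}^0_{A}$ for the system with $\mathbb F_H=\{\emptyset,*_H\}$, $\underline{\mathbb F}^\infty_A$ for the system of all $H$-sets $n\cdot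 *_H$, $E_{A}\underline{\mathbb F}$ for the extension of an $A$-weak indexing system to $G$ by $\emptyset$ at subgroups $H\not\le A$, and, for $B=e,C_p$, $\underline{\mathbb F}^{\infty}_{(B)}=\underline{\mathbb F}^0_G\vee E_B\underline{\mathbb F}^\infty_B$. For a $G$-transfer system $R$, $\underline{\mathbb F}_R$ is the indexing system of those $H$-sets all of whose orbits $[H/K]$ have $K\to H$ in $R$, and $\overline{\underline{\mathbb F}}_R$ is the join of $\underline{\mathbb F}^0_G$ and the weak indexing system generated by the sets $[H/K]$ with $K\to H$ in $R$. Let $R_0$ be the transfer system with no nontrivial transfers, and let $R_1,R_2,R_3$ be the transfer systems generated by $e\to C_p$, by $C_p\to C_{p^2}$, and by $e\to C_{p^2}$ respectively; let $R_4$ be the system of all inclusions. For a real representation $V$ of $A$, $\underline{\mathbb F}^V$ consists of the finite $H$-sets ($H\le A$) that embed $H$-equivariantly in $V$. Let $\lambda_{2}$ be any 2-dimensional representation of $G$ in which $x$ acts with order $p^2$, $\lambda_{1}$ any irreducible real representation of $G$ in which $x$ acts with order $p$, and $\lambda$ any nontrivial irreducible real representation of $C_p$. **Theorem.** The poset of unital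 $C_{p^2}$-weak indexing systems has exactly 21 elements. They are the following, sorted by fold family (rows) and transfer system: - fold family $\emptyset$: $Z=\underline{\mathbb F}^0_G$ ($R_0$); - fold family $\{e\}$: $A_0=\underline{\mathbb F}^\infty_{(e)}$ ($R_0$); $A_1=\overline{\underline{\mathbb F}}_{R_1}$, $B_1=\underline{\mathbb F}^0_G\vee E_{C_p}\underline{\mathbb F}^\lambda$ ($R_1$); $A_3=\overline{\underline{\mathbb F}}_{R_3}$, $B_3=\overline{\underline{\mathbb F}}_{R_3}\vee E_{C_p}\underline{\mathbb F}^\lambda$, $D_3=\underline{\mathbb F}^{\lambda_2}$ ($R_3$); - fold family $\{e,C_p\}$: $A'_0=\underline{\mathbb F}^\infty_{(C_p)}$ ($R_0$); $A'_1=\underline{\mathbb F}^\infty_{(C_p)}\vee\overline{\underline{\mathbb F}}_{R_1}$ ($R_1$); $A'_2=\overline{\underline{\mathbb F}}_{R_2}$, $D'_2=\underline{\mathbb F}^{\lambda_1}$ ($R_2$); $A'_3=\underline{\mathbb F}^\infty_{(C_p)}\vee\overline{\underline{\mathbb F}}_{R_3}$, $D'_3=\underline{\mathbb F}^\infty_{(C_p)}\vee\underline{\mathbb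 F}^{\lambda_2}$ ($R_3$); $A'_4=\overline{\underline{\mathbb F}}_{R_4}$, $B'_4=\overline{\underline{\mathbb F}}_{R_4}\vee\underline{\mathbb F}^{\lambda_2}$, $D'_4=\underline{\mathbb F}^{\lambda_2\oplus\lambda_1}$ ($R_4$); - fold family of all subgroups: $I_0=\underline{\mathbb F}^\infty_G$ ($R_0$), $I_j=\underline{\mathbb F}_{R_j}$ ($R_j$, $j=1,2,3,4$). The Hasse diagram (covering relations) of the poset consists of exactly the following 32 arrows, and the order is the reflexive transitive closure of these: $Z\to A_0$; $A_0\to A_1$, $A_1\to A_3$, $A_1\to B_1$, $A_3\to B_3$, $B_1\to B_3$, $B_3\to D_3$; $A_0\to A'_0$, $B_1\to A'_1$, $B_3\to A'_3$, $D_3\to D'_3$; $A'_0\to A'_1$, $A'_0\to A'_2$, $A'_1\to A'_3$, $A'_2\to A'_4$, $A'_3\to A'_4$, $A'_3\to D'_3$, $D'_3\to B'_4$, $A'_4\to B'_4$, $A'_2\to D'_2$, $D'_2\to D'_4$, $B'_4\to D'_4$; $A'_0\to I_0$, $A'_1\to I_1$, $D'_2\to I_2$, $D'_3\to I_3$, $D'_4\to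 I_4$; $I_0\to I_1$, $I_0\to I_2$, $I_1\to I_3$, $I_2\to I_4$, $I_3\to I_4$. -/

import Mathlib

universe u v w

namespace EquivariantArity

/-! ### Finite `H`-sets -/

/-- A finite set with an action of the group `H`. -/
structure FinAct (H : Type u) [Group H] where
  carrier : Type u
  [finite : Finite carrier]
  [action : MulAction H carrier]

attribute [instance] FinAct.finite FinAct.action

namespace FinAct

variable {H : Type u} [Group H] {K : Type u} [Group K]

/-- Isomorphism of finite `H`-sets. -/
def Iso (X Y : FinAct H) : Prop :=
  ∃ e : X.carrier ≃ Y.carrier, ∀ (h : H) (x : X.carrier), e (h • x) = h • e x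

/-- The `K`-set obtained from an `H`-set by letting `K` act through `f : K →* H`. -/
def restrict (f : K →* H) (X : FinAct H) : FinAct K :=
  letI : MulAction K X.carrier := MulAction.compHom X.carrier f
  ⟨X.carrier⟩

/-- The terminal `H`-set `*_H`. -/
def point (H : Type u) [Group H] : FinAct H :=
  letI : MulAction H PUnit.{u + 1} :=
    { smul := fun _ x => x, one_smul := fun _ => rfl, mul_smul := fun _ _ _ => rfl }
  ⟨PUnit.{u + 1}⟩

/-- The disjoint union of two finite `H`-sets. -/
def sum (X Y : FinAct H) : FinAct H := ⟨X.carrier ⊕ Y.carrier⟩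

/-- The disjoint union of a finite family of finite `H`-sets. -/
def coprod {ι : Type} [Finite ι] (X : ι → FinAct H) : FinAct H := ⟨Σ i, (X i).carrier⟩

/-- The inclusion of a summand. -/
def coprod.mk {ι : Type} [Finite ι] (X : ι → FinAct H) (i : ι) (x : (X i).carrier) :
    (coprod X).carrier := ⟨i, x⟩

theorem coprod.smul_mk {ι : Type} [Finite ι] (X : ι → FinAct H) (h : H) (i : ι)
    (x : (X i).carrier) : h • mk X i x = mk X i (h • x) := rfl

theorem coprod.mk_inj {ι : Type} [Finite ι] {X : ι → FinAct H} {i : ι} {x y : (X i).carrier} :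
    mk X i x = mk X i y ↔ x = y :=
  ⟨fun h => eq_of_heq (Sigma.mk.inj h).2, fun h => h ▸ rfl⟩

end FinAct

section Subgroups

variable {G : Type u} [Group G]

/-- The homomorphism `K → H`, `k ↦ g⁻¹ k g`, defined whenever `g⁻¹ K g ⊆ H`. Restriction along these
homomorphisms is the functoriality of `H`-sets in the map of orbits `G/K → G/H`, `aK ↦ a g H`. -/
def conjHom {H K : Subgroup G} (g : G) (h : ∀ k ∈ K, g⁻¹ * k * g ∈ H) : K →* H where
  toFun k := ⟨g⁻¹ * k * g, h k k.2⟩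
  map_one' := by ext; simp
  map_mul' a b := by ext; simp [mul_assoc]

/-- The stabilizer of a point of an `H`-set, regarded as a subgroup of `G`. -/
def stab {H : Subgroup G} (S : FinAct H) (s : S.carrier) : Subgroup G :=
  (MulAction.stabilizer H s).map H.subtype

theorem mem_stab {H : Subgroup G} {S : FinAct H} {s : S.carrier} {g : G} :
    g ∈ stab S s ↔ ∃ h : g ∈ H, (⟨g, h⟩ : H) • s = s := by
  simp [stab, Subgroup.mem_map]

theorem map_conj_self {H : Subgroup G} (a : H) :
    H.map (MulAut.conj (a : G)).toMonoidHom = H := by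
  ext g
  rw [Subgroup.mem_map]
  constructor
  · rintro ⟨h, hh, rfl⟩
    exact H.mul_mem (H.mul_mem a.2 hh) (H.inv_mem a.2)
  · intro hg
    exact ⟨(a : G)⁻¹ * g * a, H.mul_mem (H.mul_mem (H.inv_mem a.2) hg) a.2, by simp [mul_assoc]⟩

theorem le_of_conj {A H K : Subgroup G} {g : G} (hg : g ∈ A) (h : ∀ k ∈ K, g⁻¹ * k * g ∈ H)
    (hH : H ≤ A) : K ≤ A := fun k hk => by
  have := A.mul_mem (A.mul_mem hg (hH (h k hk))) (A.inv_mem hg)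
  simpa [mul_assoc] using this

variable [Finite G]

/-- The transitive `H`-set `[H/K]`. -/
def orbit {K H : Subgroup G} (_h : K ≤ H) : FinAct H := ⟨H ⧸ K.subgroupOf H⟩

/-- The coset `aK`, as a point of `[H/K]`. -/
def orbit.mk {K H : Subgroup G} (h : K ≤ H) (a : H) : (orbit h).carrier :=
  (QuotientGroup.mk a : H ⧸ K.subgroupOf H)

theorem orbit.smul_mk {K H : Subgroup G} (h : K ≤ H) (b a : H) :
    b • orbit.mk h a = orbit.mk h (b * a) := rfl

theorem orbit.mk_eq_iff {K H : Subgroup G} (h : K ≤ H) (a b : H) :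
    orbit.mk h a = orbit.mk h b ↔ (a : G)⁻¹ * b ∈ K := by
  unfold orbit.mk
  refine QuotientGroup.eq.trans ?_
  rw [Subgroup.mem_subgroupOf]
  simp

/-- The relation `(a, x) ∼ (a k⁻¹, k x)` on `H × X`. -/
def indSetoid {K H : Subgroup G} (h : K ≤ H) (X : FinAct K) : Setoid (H × X.carrier) where
  r a b := ∃ k : K, b = (a.1 * (Subgroup.inclusion h k)⁻¹, k • a.2)
  iseqv :=
    { refl := fun a => ⟨1, by simp⟩
      symm := by
        rintro a _ ⟨k, rfl⟩
        exact ⟨k⁻¹, by simp⟩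
      trans := by
        rintro a _ _ ⟨k, rfl⟩ ⟨l, rfl⟩
        exact ⟨l * k, by simp [mul_assoc, mul_smul]⟩ }

/-- The action of `H` on `H ×_K X`. -/
instance indAction {K H : Subgroup G} (h : K ≤ H) (X : FinAct K) :
    MulAction H (Quotient (indSetoid h X)) where
  smul a := Quotient.map (fun b => (a * b.1, b.2)) (by
    rintro b _ ⟨k, rfl⟩
    exact ⟨k, by simp [mul_assoc]⟩)
  one_smul b := by
    induction b using Quotient.inductionOn with
    | h b => exact congrArg (Quotient.mk _) (by simp)
  mul_smul a a' b := by
    induction b using Quotient.inductionOn with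
    | h b => exact congrArg (Quotient.mk _) (by simp [mul_assoc])

/-- The induced `H`-set `Ind_K^H X = H ×_K X`. -/
def ind {K H : Subgroup G} (h : K ≤ H) (X : FinAct K) : FinAct H :=
  ⟨Quotient (indSetoid h X)⟩

/-- The class of `(a, x)` in `Ind_K^H X`. -/
def ind.mk {K H : Subgroup G} (h : K ≤ H) (X : FinAct K) (a : H) (x : X.carrier) :
    (ind h X).carrier := Quotient.mk (indSetoid h X) (a, x)

theorem ind.smul_mk {K H : Subgroup G} (h : K ≤ H) (X : FinAct K) (b a : H) (x : X.carrier) :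
    b • ind.mk h X a x = ind.mk h X (b * a) x := rfl

theorem ind.mk_eq_iff {K H : Subgroup G} (h : K ≤ H) (X : FinAct K) (a b : H) (x y : X.carrier) :
    ind.mk h X a x = ind.mk h X b y ↔ ∃ k : K, b = a * (Subgroup.inclusion h k)⁻¹ ∧ y = k • x := by
  refine Quotient.eq.trans ?_
  exact exists_congr fun k => Prod.ext_iff

theorem ind.exists_rep {K H : Subgroup G} {h : K ≤ H} {X : FinAct K} (z : (ind h X).carrier) :
    ∃ a x, z = ind.mk h X a x := by
  induction z using Quotient.inductionOn with
  | h b => exact ⟨b.1, b.2, rfl⟩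

/-! ### Weak indexing systems -/

/-- A weak indexing system over the orbit category of the subgroup `A` of `G`: for every subgroup
`H ≤ A` a class of finite `H`-sets, closed under isomorphism and under restriction along all maps
of orbits `A/K → A/H`, containing `*_H` as soon as it is nonempty at `H`, and closed under
self-indexed coproducts: if `S = ∐ᵢ [H/Kᵢ]` is in the class at `H`, and `Tᵢ` is in the class at
`Kᵢ` for every `i`, then `∐ᵢ Ind_{Kᵢ}^H Tᵢ` is in the class at `H`. -/
@[ext]
structure WeakIndexingSystem (A : Subgroup G) where
  mem : ∀ H : Subgroup G, FinAct H → Prop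
  le_of_mem : ∀ {H : Subgroup G} {S : FinAct H}, mem H S → H ≤ A
  iso_mem : ∀ {H : Subgroup G} {S T : FinAct H}, S.Iso T → mem H S → mem H T
  restrict_mem : ∀ {H K : Subgroup G} {g : G} (_ : g ∈ A) (h : ∀ k ∈ K, g⁻¹ * k * g ∈ H)
    {S : FinAct H}, mem H S → mem K (S.restrict (conjHom g h))
  point_mem : ∀ {H : Subgroup G} {S : FinAct H}, mem H S → mem H (FinAct.point H)
  coprod_mem : ∀ {H : Subgroup G} {ι : Type} [Finite ι] {K : ι → Subgroup G} (hK : ∀ i, K i ≤ H)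
    (T : ∀ i, FinAct (K i)), mem H (FinAct.coprod fun i => orbit (hK i)) →
    (∀ i, mem (K i) (T i)) → mem H (FinAct.coprod fun i => ind (hK i) (T i))

namespace WeakIndexingSystem

variable {A : Subgroup G}

/-- Weak indexing systems are ordered by inclusion. -/
instance : PartialOrder (WeakIndexingSystem A) where
  le I J := ∀ (H : Subgroup G) (S : FinAct H), I.mem H S → J.mem H S
  le_refl _ _ _ h := h
  le_trans _ _ _ h h' H S hS := h' H S (h H S hS)
  le_antisymm I J h h' := by
    ext H S
    exact ⟨h H S, h' H S⟩

instance : InfSet (WeakIndexingSystem A) where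
  sInf s :=
    { mem := fun H S => H ≤ A ∧ ∀ I ∈ s, I.mem H S
      le_of_mem := fun h => h.1
      iso_mem := fun e h => ⟨h.1, fun I hI => I.iso_mem e (h.2 I hI)⟩
      restrict_mem := by
        intro H K g hg hgK S hS
        refine ⟨fun k hk => ?_, fun I hI => I.restrict_mem hg hgK (hS.2 I hI)⟩
        have := A.mul_mem (A.mul_mem hg (hS.1 (hgK k hk))) (A.inv_mem hg)
        simpa [mul_assoc] using this
      point_mem := fun h => ⟨h.1, fun I hI => I.point_mem (h.2 I hI)⟩
      coprod_mem := fun hK T hS hT =>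
        ⟨hS.1, fun I hI => I.coprod_mem hK T (hS.2 I hI) fun i => (hT i).2 I hI⟩ }

/-- Meets are intersections, and the join `I ⊔ J` is the least weak indexing system containing `I`
and `J`. -/
instance : CompleteLattice (WeakIndexingSystem A) :=
  completeLatticeOfInf _ fun s =>
    ⟨fun I hI _ _ h => h.2 I hI, fun J hJ H S h =>
      show H ≤ A ∧ ∀ I ∈ s, I.mem H S from ⟨J.le_of_mem h, fun _ hI => hJ hI H S h⟩⟩

/-- The least weak indexing system containing a given collection of finite sets. -/
def closure (P : ∀ H : Subgroup G, FinAct H → Prop) : WeakIndexingSystem A :=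
  sInf {I | ∀ (H : Subgroup G) (S : FinAct H), P H S → I.mem H S}

/-- A weak indexing system is unital if it has one color (it is nonempty at every subgroup) and is
closed under passage to summands. -/
def IsUnital (I : WeakIndexingSystem A) : Prop :=
  (∀ H ≤ A, ∃ S, I.mem H S) ∧
    ∀ (H : Subgroup G) (S S' : FinAct H), I.mem H (S.sum S') → I.mem H S ∧ I.mem H S'

variable (A) in
/-- The system `F_A^0` consisting of the empty and the one-point `H`-sets, for all `H ≤ A`. -/
def zero : WeakIndexingSystem A where
  mem H S := H ≤ A ∧ Subsingleton S.carrier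
  le_of_mem h := h.1
  iso_mem := by
    rintro H S T ⟨e, -⟩ ⟨h, h'⟩
    exact ⟨h, e.symm.subsingleton⟩
  restrict_mem hg h S hS := ⟨le_of_conj hg h hS.1, hS.2⟩
  point_mem h := ⟨h.1, inferInstanceAs (Subsingleton PUnit)⟩
  coprod_mem := by
    intro H ι _ K hK T hS hT
    refine ⟨hS.1, ⟨?_⟩⟩
    rintro ⟨i, z⟩ ⟨j, z'⟩
    obtain ⟨a, t, rfl⟩ := ind.exists_rep z
    obtain ⟨b, t', rfl⟩ := ind.exists_rep z'
    have h := hS.2.elim (FinAct.coprod.mk _ i (orbit.mk (hK i) a))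
      (FinAct.coprod.mk _ j (orbit.mk (hK j) b))
    obtain rfl : i = j := congrArg Sigma.fst h
    rw [FinAct.coprod.mk_inj, orbit.mk_eq_iff] at h
    refine congrArg (Sigma.mk i) ((ind.mk_eq_iff _ _ _ _ _ _).2 ⟨(⟨_, h⟩ : K i)⁻¹, ?_, ?_⟩)
    · ext; simp
    · exact (hT i).2.elim _ _

variable (A) in
/-- The system `F_A^∞` consisting of the `H`-sets with trivial action, i.e. the `H`-sets `n · *_H`,
for all `H ≤ A`. -/
def infty : WeakIndexingSystem A where
  mem H S := H ≤ A ∧ ∀ (h : H) (s : S.carrier), h • s = s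
  le_of_mem h := h.1
  iso_mem := by
    rintro H S T ⟨e, he⟩ ⟨h, h'⟩
    refine ⟨h, fun a t => ?_⟩
    obtain ⟨s, rfl⟩ := e.surjective t
    rw [← he, h']
  restrict_mem hg h S hS := ⟨le_of_conj hg h hS.1, fun k s => hS.2 (conjHom _ h k) s⟩
  point_mem h := ⟨h.1, fun _ _ => rfl⟩
  coprod_mem := by
    intro H ι _ K hK T hS hT
    refine ⟨hS.1, ?_⟩
    rintro b ⟨i, z⟩
    obtain ⟨a, t, rfl⟩ := ind.exists_rep z
    have h := hS.2 b (FinAct.coprod.mk _ i (orbit.mk (hK i) a))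
    rw [FinAct.coprod.smul_mk, FinAct.coprod.mk_inj, orbit.smul_mk, orbit.mk_eq_iff] at h
    refine congrArg (Sigma.mk i) ((ind.mk_eq_iff _ _ _ _ _ _).2 ⟨(⟨_, h⟩ : K i)⁻¹, ?_, ?_⟩)
    · ext; simp [mul_assoc]
    · exact ((hT i).2 _ _).symm

end WeakIndexingSystem

/-! ### Transfer systems -/

variable (G) in
/-- A `G`-transfer system: a relation on the subgroups of `G` that refines inclusion, is reflexive
and transitive, and is closed under conjugation and restriction. -/
structure TransferSystem where
  rel : Subgroup G → Subgroup G → Prop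
  le : ∀ {K H}, rel K H → K ≤ H
  refl : ∀ H, rel H H
  trans : ∀ {J K H}, rel J K → rel K H → rel J H
  conj : ∀ {K H} (g : G), rel K H →
    rel (K.map (MulAut.conj g).toMonoidHom) (H.map (MulAut.conj g).toMonoidHom)
  restrict : ∀ {K H L}, rel K H → L ≤ H → rel (K ⊓ L) L

namespace TransferSystem

variable (G) in
/-- The transfer system with no nontrivial transfers. -/
def trivial : TransferSystem G where
  rel K H := K = H
  le h := h.le
  refl _ := rfl
  trans h h' := h.trans h'
  conj _ h := h ▸ rfl
  restrict h hL := by subst h; exact inf_eq_right.2 hL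

variable (G) in
/-- The transfer system of all inclusions. -/
def complete : TransferSystem G where
  rel K H := K ≤ H
  le h := h
  refl _ := le_rfl
  trans h h' := h.trans h'
  conj _ h := Subgroup.map_mono h
  restrict _ _ := inf_le_right

/-- The least transfer system containing the inclusion `K ≤ H`. -/
def generate {K H : Subgroup G} (_h : K ≤ H) : TransferSystem G where
  rel J L := ∀ R : TransferSystem G, R.rel K H → R.rel J L
  le h := h (complete G) _h
  refl L R _ := R.refl L
  trans h h' R hR := R.trans (h R hR) (h' R hR)
  conj g h R hR := R.conj g (h R hR)
  restrict h hL R hR := R.restrict (h R hR) hL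

end TransferSystem

namespace WeakIndexingSystem

/-- The stabilizer of the base point of the summand `[H/Kᵢ]`. -/
theorem stab_coprod_orbit {H : Subgroup G} {ι : Type} [Finite ι] {K : ι → Subgroup G}
    (hK : ∀ i, K i ≤ H) (i : ι) :
    stab (FinAct.coprod fun i => orbit (hK i)) (FinAct.coprod.mk _ i (orbit.mk (hK i) 1)) =
      K i := by
  ext g
  rw [mem_stab]
  constructor
  · rintro ⟨h, hg⟩
    rw [FinAct.coprod.smul_mk, FinAct.coprod.mk_inj, orbit.smul_mk, orbit.mk_eq_iff] at hg
    simpa using hg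
  · intro hg
    refine ⟨hK i hg, ?_⟩
    rw [FinAct.coprod.smul_mk, FinAct.coprod.mk_inj, orbit.smul_mk, orbit.mk_eq_iff]
    simpa using hg

/-- The stabilizer of a point of an induced set. -/
theorem stab_coprod_ind {H : Subgroup G} {ι : Type} [Finite ι] {K : ι → Subgroup G}
    (hK : ∀ i, K i ≤ H) (T : ∀ i, FinAct (K i)) (i : ι) (a : H) (t : (T i).carrier) :
    stab (FinAct.coprod fun i => ind (hK i) (T i))
        (FinAct.coprod.mk _ i (ind.mk (hK i) (T i) a t)) =
      (stab (T i) t).map (MulAut.conj (a : G)).toMonoidHom := by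
  ext g
  rw [mem_stab, Subgroup.mem_map]
  constructor
  · rintro ⟨h, hg⟩
    rw [FinAct.coprod.smul_mk, FinAct.coprod.mk_inj, ind.smul_mk, ind.mk_eq_iff] at hg
    obtain ⟨k, hk, hk'⟩ := hg
    have hk2 : (a : G) = g * a * (k : G)⁻¹ := congrArg Subtype.val hk
    refine ⟨k, mem_stab.2 ⟨k.2, hk'.symm⟩, ?_⟩
    have : (a : G) * k = g * a := by
      conv_lhs => rw [hk2]
      simp
    simp [this]
  · rintro ⟨k, hk, rfl⟩
    obtain ⟨hk, hkt⟩ := mem_stab.1 hk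
    have hm : (a : G) * k * (a : G)⁻¹ ∈ H := H.mul_mem (H.mul_mem a.2 (hK i hk)) (H.inv_mem a.2)
    refine ⟨hm, ?_⟩
    rw [FinAct.coprod.smul_mk, FinAct.coprod.mk_inj, ind.smul_mk, ind.mk_eq_iff]
    refine ⟨⟨k, hk⟩, ?_, hkt.symm⟩
    ext; simp

/-- The indexing system `F_R` of a transfer system `R`: the `H`-sets all of whose orbits `[H/K]`
satisfy `K → H ∈ R`. -/
def ofTransfer (R : TransferSystem G) : WeakIndexingSystem (⊤ : Subgroup G) where
  mem H S := ∀ s : S.carrier, R.rel (stab S s) H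
  le_of_mem _ := le_top
  iso_mem := by
    rintro H S T ⟨e, he⟩ h t
    obtain ⟨s, rfl⟩ := e.surjective t
    have : stab T (e s) = stab S s := by
      ext g
      simp [mem_stab, ← he]
    rw [this]
    exact h s
  restrict_mem := by
    intro H K g _ hK S hS (s : S.carrier)
    have key : stab (S.restrict (conjHom g hK)) s =
        (stab S s).map (MulAut.conj g).toMonoidHom ⊓ K := by
      ext k
      rw [Subgroup.mem_inf, Subgroup.mem_map]
      refine mem_stab.trans ?_
      constructor
      · rintro ⟨hk, h⟩
        exact ⟨⟨g⁻¹ * k * g, mem_stab.2 ⟨hK k hk, h⟩, by simp [mul_assoc]⟩, hk⟩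
      · rintro ⟨⟨j, hj, rfl⟩, hk⟩
        obtain ⟨hj, hjs⟩ := mem_stab.1 hj
        refine ⟨hk, ?_⟩
        have hh : conjHom g hK ⟨_, hk⟩ = ⟨j, hj⟩ := by
          ext; simp [conjHom, mul_assoc]
        change (conjHom g hK ⟨_, hk⟩ • s : S.carrier) = s
        rw [hh, hjs]
    rw [key]
    refine R.restrict (R.conj g (hS s)) fun k hk => ?_
    exact Subgroup.mem_map.2 ⟨g⁻¹ * k * g, hK k hk, by simp [mul_assoc]⟩
  point_mem := by
    intro H S _ s
    have : stab (FinAct.point H) s = H := by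
      ext g
      rw [mem_stab]
      exact ⟨fun ⟨h, _⟩ => h, fun h => ⟨h, rfl⟩⟩
    rw [this]
    exact R.refl H
  coprod_mem := by
    rintro H ι _ K hK T hS hT ⟨i, z⟩
    obtain ⟨a, t, rfl⟩ := ind.exists_rep z
    have h1 := hS (FinAct.coprod.mk _ i (orbit.mk (hK i) 1))
    rw [stab_coprod_orbit] at h1
    have h2 := R.conj (a : G) (R.trans (hT i t) h1)
    rw [map_conj_self] at h2
    exact (stab_coprod_ind hK T i a t).symm ▸ h2

/-- The least unital weak indexing system with the transfers of `R`: the join of `F_G^0` with the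
weak indexing system generated by the orbits `[H/K]` with `K → H ∈ R`. -/
def bar (R : TransferSystem G) : WeakIndexingSystem (⊤ : Subgroup G) :=
  zero ⊤ ⊔ closure fun H S => ∃ (K : Subgroup G) (h : K ≤ H), R.rel K H ∧ S.Iso (orbit h)

/-- The arity support `F^V` of a real representation `V` of `A`: the finite `H`-sets that embed
`H`-equivariantly into `V`, for all `H ≤ A`. -/
def aritySupport {A : Subgroup G} {V : Type v} [AddCommGroup V] [Module ℝ V]
    (ρ : Representation ℝ A V) : WeakIndexingSystem A where
  mem H S := ∃ hH : H ≤ A, ∃ e : S.carrier → V, Function.Injective e ∧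
    ∀ (h : H) (s : S.carrier), e (h • s) = ρ (Subgroup.inclusion hH h) (e s)
  le_of_mem h := h.1
  iso_mem := by
    rintro H S T ⟨f, hf⟩ ⟨hH, e, he, hes⟩
    refine ⟨hH, e ∘ f.symm, he.comp f.symm.injective, fun h t => ?_⟩
    obtain ⟨s, rfl⟩ := f.surjective t
    simp [← hf, hes]
  restrict_mem := by
    rintro H K g hg hK S ⟨hH, e, he, hes⟩
    refine ⟨le_of_conj hg hK hH, fun s : S.carrier => ρ ⟨g, hg⟩ (e s), ?_,
      fun k (s : S.carrier) => ?_⟩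
    · intro (s : S.carrier) (t : S.carrier) hst
      have := congrArg (ρ (⟨g, hg⟩ : A)⁻¹) hst
      simp only [← Module.End.mul_apply, ← map_mul] at this
      simp only [inv_mul_cancel, map_one, Module.End.one_apply] at this
      exact he this
    · change ρ ⟨g, hg⟩ (e (conjHom g hK k • s : S.carrier)) = _
      rw [hes, ← Module.End.mul_apply, ← Module.End.mul_apply, ← map_mul, ← map_mul]
      congr 2
      ext; simp [conjHom, mul_assoc]
  point_mem := by
    rintro H S ⟨hH, -⟩
    exact ⟨hH, fun _ => 0, fun _ _ _ => rfl, fun _ _ => by simp⟩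
  coprod_mem := by
    rintro H ι _ K hK T ⟨hH, c, hc, hcs⟩ hT
    choose hKA e he hes using hT
    -- the point of `V` at which the copy of `Tᵢ` is centered
    let b : ι → V := fun i => c (FinAct.coprod.mk _ i (orbit.mk (hK i) 1))
    let r : H → V →ₗ[ℝ] V := fun h => ρ (Subgroup.inclusion hH h)
    have hr : ∀ g h v, r (g * h) v = r g (r h v) := fun g h v => by
      simp only [r, map_mul, Module.End.mul_apply]
    have hb : ∀ (i : ι) (h : H), r h (b i) = c (FinAct.coprod.mk _ i (orbit.mk (hK i) h)) := by
      intro i h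
      refine (hcs _ _).symm.trans (congrArg c ?_)
      rw [FinAct.coprod.smul_mk, orbit.smul_mk, mul_one]
    have hbk : ∀ (i : ι) (k : K i), r (Subgroup.inclusion (hK i) k) (b i) = b i := by
      intro i k
      rw [hb]
      refine congrArg c ?_
      rw [FinAct.coprod.mk_inj, orbit.mk_eq_iff]
      simp
    have hek : ∀ (i : ι) (k : K i) (t : (T i).carrier),
        r (Subgroup.inclusion (hK i) k) (e i t) = e i (k • t) := by
      intro i k t
      exact (hes i k t).symm
    let P := Σ i, H × (T i).carrier
    have hfin : Finite P := inferInstance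
    -- finitely many scales are bad
    let bad : Set ℝ := ⋃ q : P × P,
      {ε : ℝ | r q.1.2.1 (b q.1.1) ≠ r q.2.2.1 (b q.2.1) ∧
        r q.1.2.1 (b q.1.1 + ε • e q.1.1 q.1.2.2) = r q.2.2.1 (b q.2.1 + ε • e q.2.1 q.2.2.2)}
    have hbad : bad.Finite := by
      refine Set.finite_iUnion fun q => Set.Subsingleton.finite ?_
      rintro ε ⟨hne, h1⟩ δ ⟨-, h2⟩
      by_contra hεδ
      simp only [map_add, map_smul] at h1 h2
      apply hne
      have h3 : (ε - δ) • r q.1.2.1 (e q.1.1 q.1.2.2) = (ε - δ) • r q.2.2.1 (e q.2.1 q.2.2.2) := by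
        have := congrArg₂ (· - ·) h1 h2
        simp only [add_sub_add_left_eq_sub] at this
        rw [sub_smul, sub_smul]
        exact this
      have h4 := smul_right_injective V (sub_ne_zero.2 hεδ) h3
      rw [h4] at h1
      exact add_right_cancel h1
    obtain ⟨ε, hε⟩ := (hbad.union (Set.finite_singleton 0)).infinite_compl.nonempty
    have hε0 : ε ≠ 0 := fun h => hε (Or.inr h)
    have hεb : ε ∉ bad := fun h => hε (Or.inl h)
    let f : (Σ i, (ind (hK i) (T i)).carrier) → V := fun z =>
      Quotient.lift (s := indSetoid (hK z.1) (T z.1)) (fun a => r a.1 (b z.1 + ε • e z.1 a.2)) (by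
        rintro a _ ⟨k, rfl⟩
        simp only
        rw [← hek, ← hbk z.1 k, ← map_smul, ← map_add, ← hr, hbk]
        simp) z.2
    have hf : ∀ (i : ι) (a : H) (t : (T i).carrier),
        f ⟨i, ind.mk (hK i) (T i) a t⟩ = r a (b i + ε • e i t) := fun _ _ _ => rfl
    refine ⟨hH, f, ?_, ?_⟩
    · rintro ⟨i, z⟩ ⟨j, z'⟩ h
      obtain ⟨a, t, rfl⟩ := ind.exists_rep z
      obtain ⟨a', t', rfl⟩ := ind.exists_rep z'
      rw [hf, hf] at h
      have h1 : r a (b i) = r a' (b j) := by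
        by_contra hne
        exact hεb (Set.mem_iUnion.2 ⟨(⟨i, a, t⟩, ⟨j, a', t'⟩), hne, h⟩)
      have h2 := h1
      rw [hb, hb] at h2
      have h2 := hc h2
      obtain rfl : i = j := congrArg Sigma.fst h2
      have h3 := FinAct.coprod.mk_inj.1 h2
      rw [orbit.mk_eq_iff] at h3
      let k : K i := (⟨_, h3⟩ : K i)⁻¹
      have ha' : a' = a * (Subgroup.inclusion (hK i) k)⁻¹ := by
        ext; simp [k]
      have ha : a = a' * Subgroup.inclusion (hK i) k := by rw [ha']; simp
      refine congrArg (Sigma.mk i) ((ind.mk_eq_iff _ _ _ _ _ _).2 ⟨k, ha', ?_⟩)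
      rw [map_add, map_add, h1] at h
      have h4 := add_left_cancel h
      rw [map_smul, map_smul] at h4
      have h5 := smul_right_injective V hε0 h4
      rw [ha, hr, hek] at h5
      have h6 : e i (k • t) = e i t' := by
        have := congrArg (r a'⁻¹) h5
        rw [← hr, ← hr] at this
        simpa [r] using this
      exact (he i h6).symm
    · rintro g ⟨i, z⟩
      obtain ⟨a, t, rfl⟩ := ind.exists_rep z
      exact hr g a _

end WeakIndexingSystem

end Subgroups

/-! ### Constructions for abelian groups -/

section Abelian

variable {G : Type u} [CommGroup G] [Finite G]

namespace WeakIndexingSystem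

/-- The extension `E_A^B I` of an `A`-weak indexing system to `B ≥ A`: its value at `H` is that of `I`
if `H ≤ A`, and empty otherwise. Since `G` is abelian, this is stable under conjugation. -/
def extend {A : Subgroup G} (B : Subgroup G) (hAB : A ≤ B) (I : WeakIndexingSystem A) :
    WeakIndexingSystem B where
  mem := I.mem
  le_of_mem h := (I.le_of_mem h).trans hAB
  iso_mem := I.iso_mem
  restrict_mem := by
    intro H K g _ h S hS
    have h1 : ∀ k ∈ K, (1 : G)⁻¹ * k * 1 ∈ H := fun k hk => by
      have := h k hk
      rw [mul_comm g⁻¹ k, inv_mul_cancel_right] at this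
      simpa using this
    have heq : conjHom g h = conjHom 1 h1 := by
      ext k
      simp [conjHom]
    rw [heq]
    exact I.restrict_mem A.one_mem h1 hS
  point_mem := I.point_mem
  coprod_mem := I.coprod_mem

/-- The least unital `G`-weak indexing system containing `2 · *_H` for all `H ≤ B`: the join of `F_G^0`
with the extension of `F_B^∞`. -/
def fold (B : Subgroup G) : WeakIndexingSystem (⊤ : Subgroup G) :=
  zero ⊤ ⊔ extend ⊤ le_top (infty B)

end WeakIndexingSystem

end Abelian

/-! ### The Hasse diagram -/

/-- The 21 vertices. -/
inductive Vertex
  | zero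
  | foldE | bar1 | bar3
  | ext1 | ext3 | disk3
  | foldC | foldCBar1 | bar2 | foldCBar3 | bar4
  | foldCDisk3 | barDisk | disk2 | diskSum
  | foldG | full1 | full2 | full3 | full4
  deriving DecidableEq

open Vertex in
/-- The 32 arrows `a → b`, listed as pairs `(a, b)`. -/
def arrows : List (Vertex × Vertex) :=
  [(zero, foldE),
   (foldE, bar1), (bar1, bar3), (bar1, ext1), (bar3, ext3), (ext1, ext3), (ext3, disk3),
   (foldE, foldC), (ext1, foldCBar1), (ext3, foldCBar3), (disk3, foldCDisk3),
   (foldC, foldCBar1), (foldC, bar2), (foldCBar1, foldCBar3), (bar2, bar4), (foldCBar3, bar4),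
   (foldCBar3, foldCDisk3), (foldCDisk3, barDisk), (bar4, barDisk), (bar2, disk2),
   (disk2, diskSum), (barDisk, diskSum),
   (foldC, foldG), (foldCBar1, full1), (disk2, full2), (foldCDisk3, full3), (diskSum, full4),
   (foldG, full1), (foldG, full2), (full1, full3), (full2, full4), (full3, full4)]

section Labels

open WeakIndexingSystem

variable {G : Type u} [CommGroup G] [Finite G]

/-- The transfer system of a vertex, for `G` cyclic of order `p²` and `C` its subgroup of order `p`. -/
def Vertex.transfer (C : Subgroup G) : Vertex → TransferSystem G
  | .zero | .foldE | .foldC | .foldG => TransferSystem.trivial G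
  | .bar1 | .ext1 | .foldCBar1 | .full1 => TransferSystem.generate (bot_le : ⊥ ≤ C)
  | .bar2 | .disk2 | .full2 => TransferSystem.generate (le_top : C ≤ ⊤)
  | .bar3 | .ext3 | .disk3 | .foldCBar3 | .foldCDisk3 | .full3 =>
    TransferSystem.generate (bot_le : (⊥ : Subgroup G) ≤ ⊤)
  | .bar4 | .barDisk | .diskSum | .full4 => TransferSystem.complete G

/-- The family of subgroups `H` over which the vertex contains the fold map `2 · *_H`. -/
def Vertex.foldFamily (C : Subgroup G) : Vertex → Set (Subgroup G)
  | .zero => ∅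
  | .foldE | .bar1 | .bar3 | .ext1 | .ext3 | .disk3 => {H | H ≤ ⊥}
  | .foldC | .foldCBar1 | .bar2 | .foldCBar3 | .bar4 | .foldCDisk3 | .barDisk | .disk2 | .diskSum =>
    {H | H ≤ C}
  | .foldG | .full1 | .full2 | .full3 | .full4 => Set.univ

/-- The arity support of a representation of `G`. -/
noncomputable def disks {V : Type v} [AddCommGroup V] [Module ℝ V] (ρ : Representation ℝ G V) :
    WeakIndexingSystem (⊤ : Subgroup G) :=
  aritySupport (ρ.comp (⊤ : Subgroup G).subtype)

variable {V : Type v} [AddCommGroup V] [Module ℝ V] {W : Type w} [AddCommGroup W] [Module ℝ W]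
  {U : Type*} [AddCommGroup U] [Module ℝ U]

/-- The label of a vertex, for `G` cyclic of order `p²`, `C` its subgroup of order `p`, and given
representations `ρ₂` and `ρ₁` of `G` and `ρ₀` of `C`. -/
noncomputable def Vertex.label (C : Subgroup G) (ρ₂ : Representation ℝ G V)
    (ρ₁ : Representation ℝ G W) (ρ₀ : Representation ℝ C U) :
    Vertex → WeakIndexingSystem (⊤ : Subgroup G)
  | .zero => WeakIndexingSystem.zero ⊤
  | .foldE => fold ⊥
  | .bar1 => bar (TransferSystem.generate (bot_le : ⊥ ≤ C))
  | .bar3 => bar (TransferSystem.generate (bot_le : (⊥ : Subgroup G) ≤ ⊤))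
  | .ext1 => WeakIndexingSystem.zero ⊤ ⊔ extend ⊤ le_top (aritySupport ρ₀)
  | .ext3 => bar (TransferSystem.generate (bot_le : (⊥ : Subgroup G) ≤ ⊤)) ⊔
      extend ⊤ le_top (aritySupport ρ₀)
  | .disk3 => disks ρ₂
  | .foldC => fold C
  | .foldCBar1 => fold C ⊔ bar (TransferSystem.generate (bot_le : ⊥ ≤ C))
  | .bar2 => bar (TransferSystem.generate (le_top : C ≤ ⊤))
  | .foldCBar3 => fold C ⊔ bar (TransferSystem.generate (bot_le : (⊥ : Subgroup G) ≤ ⊤))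
  | .bar4 => bar (TransferSystem.complete G)
  | .foldCDisk3 => fold C ⊔ disks ρ₂
  | .barDisk => bar (TransferSystem.complete G) ⊔ disks ρ₂
  | .disk2 => disks ρ₁
  | .diskSum => disks (ρ₂.prod ρ₁)
  | .foldG => infty ⊤
  | .full1 => ofTransfer (TransferSystem.generate (bot_le : ⊥ ≤ C))
  | .full2 => ofTransfer (TransferSystem.generate (le_top : C ≤ ⊤))
  | .full3 => ofTransfer (TransferSystem.generate (bot_le : (⊥ : Subgroup G) ≤ ⊤))
  | .full4 => ofTransfer (TransferSystem.complete G)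

end Labels

end EquivariantArity

open EquivariantArity

namespace EquivariantArity

/-! ### Finite `H`-sets over a base -/

/-! When the subgroups of an abelian group form a chain, a unital weak indexing system is determined
by two relations: `r K H`, that `[H/K]` is admissible, and `q K H`, that `[H/K] ⊔ *` is admissible.
An `H`-set is admissible exactly when every stabilizer is `r`-related to `H` and, whenever there is
a fixed point, the stabilizer of each other point is `q`-related to `H`.

The engine is `mem_of_fiber`: a set mapping equivariantly to an admissible set with admissible
fibers is admissible. That the test suffices (`eq_ofPattern`) follows by choosing a small target. A
set without fixed points maps to its orbit `[H/K]` with greatest stabilizer, and the fibers live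
over `K < H`; there `q` is automatic, because `[H/K]` restricted to `K` already contains `2 · *_K`.
With one fixed point the target is `[H/K] ⊔ *`; with several it is `2 · *_H`, which splits off one
fixed point at a time.

The relations that occur are those satisfying `IsPattern`: `isPattern` extracts a pattern from a
system and `ofPattern` builds a system from a pattern. For a cyclic group of order `p²` a pattern
lives on a three-element chain and amounts to nine truth values, so enumeration (`exists_code`)
leaves the 21 vertices, and `covBy_iff` reads off the Hasse diagram.

The labels are identified by `system_eq` and `ofTransfer_eq`. In the former a label is already known
to be one of the 21 systems; its generators bound it above, and at most two transfers or pointed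
transfers exclude everything smaller. For irreducible supports the input is that all nonzero vectors
have the same stabilizer: trivial for `λ₂` and `λ`, and `C_p` for `λ₁`. -/

theorem FinAct.Iso.symm {H : Type u} [Group H] {X Y : FinAct H} (h : X.Iso Y) : Y.Iso X := by
  obtain ⟨e, he⟩ := h
  refine ⟨e.symm, fun a y => ?_⟩
  rw [Equiv.symm_apply_eq, he, Equiv.apply_symm_apply]

namespace FinAct

variable {H : Type u} [Group H] {K : Type u} [Group K]

/-- The point of `*_H`. -/
def star (H : Type u) [Group H] : (point H).carrier := PUnit.unit

/-- The inclusion of the first summand. -/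
def inl (X Y : FinAct H) (x : X.carrier) : (X.sum Y).carrier := Sum.inl x

/-- The inclusion of the second summand. -/
def inr (X Y : FinAct H) (y : Y.carrier) : (X.sum Y).carrier := Sum.inr y

theorem inl_ne_inr {X Y : FinAct H} (x : X.carrier) (y : Y.carrier) : X.inl Y x ≠ X.inr Y y :=
  Sum.inl_ne_inr

theorem eq_inl_or_inr {X Y : FinAct H} (z : (X.sum Y).carrier) :
    (∃ x, z = X.inl Y x) ∨ ∃ y, z = X.inr Y y :=
  Sum.rec (fun x => Or.inl ⟨x, rfl⟩) (fun y => Or.inr ⟨y, rfl⟩) z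

theorem smul_inl {X Y : FinAct H} (h : H) (x : X.carrier) : h • X.inl Y x = X.inl Y (h • x) := rfl

/-- The point of `X` underlying a point of the restriction of `X`. -/
def ofRestrict {f : K →* H} {X : FinAct H} (x : (X.restrict f).carrier) : X.carrier := x

/-- A point of `X`, as a point of the restriction of `X`. -/
def toRestrict (f : K →* H) {X : FinAct H} (x : X.carrier) : (X.restrict f).carrier := x

theorem toRestrict_injective (f : K →* H) {X : FinAct H} :
    Function.Injective (toRestrict f : X.carrier → (X.restrict f).carrier) := fun _ _ h => h

theorem ofRestrict_toRestrict (f : K →* H) {X : FinAct H} (x : X.carrier) :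
    ofRestrict (toRestrict f x) = x := rfl

theorem ofRestrict_injective {f : K →* H} {X : FinAct H} :
    Function.Injective (ofRestrict : (X.restrict f).carrier → X.carrier) := fun _ _ h => h

theorem ofRestrict_smul {f : K →* H} {X : FinAct H} (k : K) (x : (X.restrict f).carrier) :
    ofRestrict (k • x) = f k • ofRestrict x := rfl

end FinAct

/-! ### Stabilizers, fibers and equivariant maps -/

section Fibers

variable {G : Type u} [Group G] {H : Subgroup G}

theorem stab_le (S : FinAct H) (s : S.carrier) : stab S s ≤ H := fun _ hg => (mem_stab.1 hg).1

/-- The fiber of an equivariant map over `s`, as a set over the stabilizer of `s`. -/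
def fiber {X S : FinAct H} (f : X.carrier → S.carrier)
    (hf : ∀ (h : H) (x : X.carrier), f (h • x) = h • f x) (s : S.carrier) : FinAct (stab S s) :=
  letI : MulAction (stab S s) {x // f x = s} :=
    { smul := fun k x => ⟨(⟨k, stab_le S s k.2⟩ : H) • x.1, by
        rw [hf, x.2]
        exact (mem_stab.1 k.2).2⟩
      one_smul := fun x => Subtype.ext (one_smul H x.1)
      mul_smul := fun a b x => Subtype.ext
        (mul_smul (⟨a, stab_le S s a.2⟩ : H) ⟨b, stab_le S s b.2⟩ x.1) }
  ⟨{x // f x = s}⟩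

theorem stab_fiber {X S : FinAct H} (f : X.carrier → S.carrier)
    (hf : ∀ (h : H) (x : X.carrier), f (h • x) = h • f x) (s : S.carrier)
    (x : {x // f x = s}) : stab (fiber f hf s) x = stab X x.1 := by
  ext g
  constructor
  · intro hg
    obtain ⟨h, hx⟩ := mem_stab.1 hg
    exact mem_stab.2 ⟨stab_le S s h, congrArg Subtype.val hx⟩
  · intro hg
    obtain ⟨h, hx⟩ := mem_stab.1 hg
    refine mem_stab.2 ⟨mem_stab.2 ⟨h, ?_⟩, Subtype.ext hx⟩
    rw [← x.2, ← hf, hx]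

theorem stab_eq_of_injective {X S : FinAct H} {f : X.carrier → S.carrier}
    (hf : ∀ (h : H) (x : X.carrier), f (h • x) = h • f x) (hi : Function.Injective f)
    (x : X.carrier) : stab S (f x) = stab X x := by
  ext g
  simp only [mem_stab, ← hf, hi.eq_iff]

theorem stab_eq_iff {S : FinAct H} {s : S.carrier} : stab S s = H ↔ ∀ h : H, h • s = s := by
  constructor
  · intro h a
    obtain ⟨_, ha⟩ := mem_stab.1 (h.symm ▸ a.2 : (a : G) ∈ stab S s)
    exact ha
  · intro h
    exact le_antisymm (stab_le S s) fun g hg => mem_stab.2 ⟨hg, h ⟨g, hg⟩⟩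

theorem smul_eq_smul_iff_stab {S : FinAct H} {s : S.carrier} {a b : H} :
    a • s = b • s ↔ (a : G)⁻¹ * b ∈ stab S s := by
  rw [mem_stab, eq_comm, ← inv_smul_eq_iff, smul_smul]
  exact ⟨fun h => ⟨(a⁻¹ * b).2, h⟩, fun ⟨_, h⟩ => h⟩

/-- An equivariant map carrying a representative of every orbit to a prescribed point. -/
theorem exists_equivariant {X S : FinAct H} (g : X.carrier → S.carrier)
    (hg : ∀ x, stab X x ≤ stab S (g x)) :
    ∃ f : X.carrier → S.carrier, (∀ (h : H) (x : X.carrier), f (h • x) = h • f x) ∧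
      ∀ x, ∃ (h : H) (y : X.carrier), x = h • y ∧ f x = h • g y := by
  let r : X.carrier → X.carrier := fun x => (Quotient.mk (MulAction.orbitRel H X.carrier) x).out
  have hr : ∀ x, ∃ h : H, h • r x = x := fun x =>
    MulAction.orbitRel_apply.1 ((MulAction.orbitRel H X.carrier).symm
      (Quotient.mk_out (s := MulAction.orbitRel H X.carrier) x))
  have hrs : ∀ (h : H) x, r (h • x) = r x := fun h x =>
    congrArg Quotient.out (Quotient.sound (MulAction.orbitRel_apply.2 ⟨h, rfl⟩))
  choose a ha using hr
  refine ⟨fun x => a x • g (r x), fun h x => ?_, fun x => ⟨a x, r x, (ha x).symm, rfl⟩⟩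
  simp only [hrs]
  -- Both `a (h • x)` and `h * a x` carry the representative `r x` to `h • x`, so they differ by an
  -- element of its stabilizer, which also fixes `g (r x)`.
  rw [smul_smul, smul_eq_smul_iff_stab]
  refine hg _ (smul_eq_smul_iff_stab.1 ?_)
  rw [mul_smul, ha, ← hrs h x, ha]

theorem stab_point (s : (FinAct.point H).carrier) : stab (FinAct.point H) s = H :=
  stab_eq_iff.2 fun _ => rfl

theorem stab_inl {S T : FinAct H} (s : S.carrier) : stab (S.sum T) (S.inl T s) = stab S s :=
  stab_eq_of_injective (f := S.inl T) (fun _ _ => rfl) Sum.inl_injective s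

theorem stab_inr {S T : FinAct H} (t : T.carrier) : stab (S.sum T) (S.inr T t) = stab T t :=
  stab_eq_of_injective (f := S.inr T) (fun _ _ => rfl) Sum.inr_injective t

end Fibers

/-! ### Self-indexed coproducts as maps with admissible fibers -/

section Orbits

variable {G : Type u} [Group G] [Finite G] {H : Subgroup G}

/-- The equivariant map `[H/K] → S`, `aK ↦ a s`. -/
def orbitMap {K : Subgroup G} (hK : K ≤ H) {S : FinAct H} {s : S.carrier} (hs : K ≤ stab S s) :
    (orbit hK).carrier → S.carrier :=
  Quotient.lift (fun a : H => a • s) fun a b hab =>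
    smul_eq_smul_iff_stab.2 (hs ((orbit.mk_eq_iff hK a b).1 (Quotient.sound hab)))

theorem orbit.exists_rep {K : Subgroup G} {hK : K ≤ H} (z : (orbit hK).carrier) :
    ∃ a, z = orbit.mk hK a := by
  induction z using Quotient.inductionOn with
  | h a => exact ⟨a, rfl⟩

theorem orbitMap_mk {K : Subgroup G} (hK : K ≤ H) {S : FinAct H} {s : S.carrier}
    (hs : K ≤ stab S s) (a : H) : orbitMap hK hs (orbit.mk hK a) = a • s := rfl

theorem orbitMap_smul {K : Subgroup G} (hK : K ≤ H) {S : FinAct H} {s : S.carrier}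
    (hs : K ≤ stab S s) (h : H) (z : (orbit hK).carrier) :
    orbitMap hK hs (h • z) = h • orbitMap hK hs z := by
  obtain ⟨a, rfl⟩ := orbit.exists_rep z
  rw [orbit.smul_mk, orbitMap_mk, orbitMap_mk, mul_smul]

theorem orbitMap_injective {S : FinAct H} (s : S.carrier) :
    Function.Injective (orbitMap (stab_le S s) (le_refl (stab S s))) := by
  intro z z' h
  obtain ⟨a, rfl⟩ := orbit.exists_rep z
  obtain ⟨b, rfl⟩ := orbit.exists_rep z'
  rw [orbitMap_mk, orbitMap_mk, smul_eq_smul_iff_stab] at h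
  exact (orbit.mk_eq_iff _ a b).2 h

theorem stab_orbit_one {K : Subgroup G} (hK : K ≤ H) : stab (orbit hK) (orbit.mk hK 1) = K := by
  ext g
  rw [mem_stab]
  simp only [orbit.smul_mk, mul_one]
  refine ⟨fun ⟨h, hg⟩ => ?_, fun hg => ⟨hK hg, ?_⟩⟩
  · simpa using (orbit.mk_eq_iff hK _ _).1 hg.symm
  · exact ((orbit.mk_eq_iff hK _ _).2 (by simpa using hg)).symm

/-- The set `[H/K] ⊔ *` embeds in `S` as soon as `S` has a point with stabilizer `K` and a different
fixed point. -/
theorem orbit_sum_point_injective {S : FinAct H} {s t : S.carrier} (hst : s ≠ t)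
    (ht : stab S t = H) :
    Function.Injective (Sum.elim (orbitMap (stab_le S s) le_rfl) fun _ : PUnit.{u + 1} => t) := by
  refine (orbitMap_injective s).sumElim (fun _ _ _ => rfl) fun z _ h => hst ?_
  obtain ⟨a, rfl⟩ := orbit.exists_rep z
  rw [orbitMap_mk] at h
  rw [← inv_smul_smul a s, h]
  exact stab_eq_iff.1 ht _

namespace WeakIndexingSystem

variable {A : Subgroup G} {I J : WeakIndexingSystem A}

/-- Closure under self-indexed coproducts in terms of equivariant maps: if `S` is admissible and
every orbit of `S` contains a point over which the fiber is admissible, then the total space is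
admissible. -/
theorem mem_of_fiber {X S : FinAct H} (f : X.carrier → S.carrier)
    (hf : ∀ (h : H) (x : X.carrier), f (h • x) = h • f x) (hS : I.mem H S)
    (h : ∀ s : S.carrier, ∃ a : H, I.mem (stab S (a • s)) (fiber f hf (a • s))) : I.mem H X := by
  obtain ⟨n, ⟨e⟩⟩ := Finite.exists_equiv_fin (MulAction.orbitRel.Quotient H S.carrier)
  choose a ha using h
  -- One representative of each orbit of `S`, translated to a point where the fiber is known to be
  -- admissible.
  let r : Fin n → S.carrier := fun i => a (e.symm i).out • (e.symm i).out
  have hr : ∀ i, (Quotient.mk (MulAction.orbitRel H S.carrier) (r i)) = e.symm i := fun i =>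
    (Quotient.sound (MulAction.orbitRel_apply.2 ⟨_, rfl⟩)).trans (Quotient.out_eq _)
  have hrm : ∀ i, I.mem (stab S (r i)) (fiber f hf (r i)) := fun i => ha _
  have hrs : ∀ s, ∃ (i : Fin n) (b : H), b • r i = s := fun s => by
    refine ⟨e (Quotient.mk (MulAction.orbitRel H S.carrier) s),
      MulAction.orbitRel_apply.1 (Quotient.exact ?_)⟩
    rw [hr, e.symm_apply_apply]
  have hri : ∀ i j (b c : H), b • r i = c • r j → i = j := fun i j b c hbc => by
    apply e.symm.injective
    rw [← hr i, ← hr j]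
    refine Quotient.sound (MulAction.orbitRel_apply.2 ⟨b⁻¹ * c, ?_⟩)
    simp only [mul_smul, ← hbc, inv_smul_smul]
  clear_value r
  -- The base decomposes as the coproduct of its orbits; the total space is then the coproduct of
  -- the fibers over the `r i`, induced up to `H`.
  have h1 : (FinAct.coprod fun i => orbit (stab_le S (r i))).Iso S := by
    refine ⟨Equiv.ofBijective
      (fun z : Σ i, (orbit (stab_le S (r i))).carrier => orbitMap (stab_le S (r z.1)) le_rfl z.2)
      ⟨?_, fun s => ?_⟩, fun h z => orbitMap_smul _ (le_refl (stab S (r z.1))) h z.2⟩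
    · rintro ⟨i, z⟩ ⟨j, z'⟩ hz
      obtain ⟨b, rfl⟩ := orbit.exists_rep z
      obtain ⟨c, rfl⟩ := orbit.exists_rep z'
      obtain rfl := hri _ _ _ _ hz
      exact congrArg (Sigma.mk i) (orbitMap_injective _ hz)
    · obtain ⟨i, b, hb⟩ := hrs s
      exact ⟨⟨i, orbit.mk _ b⟩, hb⟩
  have h2 := I.coprod_mem (fun i => stab_le S (r i)) (fun i => fiber f hf (r i))
    (I.iso_mem h1.symm hS) hrm
  refine I.iso_mem ?_ h2
  let F : ∀ i, (ind (stab_le S (r i)) (fiber f hf (r i))).carrier → X.carrier := fun i =>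
    Quotient.lift (s := indSetoid (stab_le S (r i)) (fiber f hf (r i)))
      (fun z => z.1 • (z.2 : {x // f x = r i}).1) (by
        rintro ⟨b, x⟩ _ ⟨k, rfl⟩
        change b • x.1 = (b * (Subgroup.inclusion (stab_le S (r i)) k)⁻¹) •
          (Subgroup.inclusion (stab_le S (r i)) k) • x.1
        rw [mul_smul, inv_smul_smul])
  have hF : ∀ i b x, F i (ind.mk _ _ b x) = b • (x : {x // f x = r i}).1 := fun _ _ _ => rfl
  refine ⟨Equiv.ofBijective
    (fun z : Σ i, (ind (stab_le S (r i)) (fiber f hf (r i))).carrier => F z.1 z.2)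
    ⟨?_, fun x => ?_⟩, ?_⟩
  · rintro ⟨i, z⟩ ⟨j, z'⟩ hz
    obtain ⟨b, x, rfl⟩ := ind.exists_rep z
    obtain ⟨c, y, rfl⟩ := ind.exists_rep z'
    have hz : b • (x : {x // f x = r i}).1 = c • (y : {x // f x = r j}).1 := hz
    have hz' := congrArg f hz
    rw [hf, hf, x.2, y.2] at hz'
    obtain rfl := hri _ _ _ _ hz'
    have hk := smul_eq_smul_iff_stab.1 hz'.symm
    refine congrArg (Sigma.mk i) ((ind.mk_eq_iff _ _ _ _ _ _).2 ⟨⟨_, hk⟩, ?_, Subtype.ext ?_⟩)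
    · ext; simp
    · change y.1 = (c⁻¹ * b) • x.1
      rw [mul_smul, hz, inv_smul_smul]
  · obtain ⟨i, b, hb⟩ := hrs (f x)
    refine ⟨⟨i, ind.mk _ _ b (⟨b⁻¹ • x, ?_⟩ : {x // f x = r i})⟩, smul_inv_smul b x⟩
    rw [hf, ← hb, inv_smul_smul]
  · rintro h ⟨i, z⟩
    obtain ⟨b, x, rfl⟩ := ind.exists_rep z
    exact mul_smul h b x.1

/-- Fibers of an injection have at most one point, hence are admissible in a unital system. -/
theorem mem_of_injective (h0 : zero A ≤ I) {X S : FinAct H} (f : X.carrier → S.carrier)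
    (hf : ∀ (h : H) (x : X.carrier), f (h • x) = h • f x) (hi : Function.Injective f)
    (hS : I.mem H S) : I.mem H X :=
  mem_of_fiber f hf hS fun _ => ⟨1, h0 _ _ ⟨(stab_le S _).trans (I.le_of_mem hS),
    ⟨fun x y => Subtype.ext (hi (x.2.trans y.2.symm))⟩⟩⟩

/-- A weak indexing system is unital if and only if it contains all empty and one-point sets. -/
theorem isUnital_iff : I.IsUnital ↔ zero A ≤ I := by
  constructor
  · rintro ⟨h1, h2⟩ H S ⟨hH, hS⟩
    obtain ⟨T, hT⟩ := h1 H hH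
    have hp := I.point_mem hT
    -- The empty set is obtained as a summand of `*_H ≅ *_H ⊔ ∅`.
    let E : FinAct H :=
      letI : MulAction H PEmpty.{u + 1} :=
        { smul := fun _ x => x, one_smul := fun x => x.elim, mul_smul := fun _ _ x => x.elim }
      ⟨PEmpty.{u + 1}⟩
    have hE : I.mem H E := (h2 H (FinAct.point H) E (I.iso_mem
      ⟨(Equiv.sumEmpty PUnit.{u + 1} PEmpty.{u + 1}).symm, fun _ _ => rfl⟩ hp)).2
    rcases isEmpty_or_nonempty S.carrier with he | ⟨⟨s⟩⟩
    · exact I.iso_mem (S := E) ⟨(Equiv.equivPEmpty.{_, u + 1} S.carrier).symm,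
        fun _ (x : PEmpty.{u + 1}) => x.elim⟩ hE
    · exact I.iso_mem ⟨⟨fun _ => s, fun _ => PUnit.unit, fun _ => rfl, fun _ => hS.elim _ _⟩,
        fun _ _ => hS.elim _ _⟩ hp
  · intro h0
    refine ⟨fun H hH => ⟨FinAct.point H, h0 _ _ ⟨hH, inferInstanceAs (Subsingleton PUnit)⟩⟩,
      fun H S S' h => ⟨?_, ?_⟩⟩
    · exact mem_of_injective h0 (S := S.sum S') Sum.inl (fun _ _ => rfl) Sum.inl_injective h
    · exact mem_of_injective h0 (S := S.sum S') Sum.inr (fun _ _ => rfl) Sum.inr_injective h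

theorem orbit_mem_of_mem (h0 : zero A ≤ I) {S : FinAct H} (hS : I.mem H S) {s : S.carrier}
    {K : Subgroup G} (hK : K ≤ H) (hs : stab S s = K) : I.mem H (orbit hK) := by
  subst hs
  exact mem_of_injective h0 _ (orbitMap_smul _ _) (orbitMap_injective s) hS

theorem orbit_sum_point_mem_of_mem (h0 : zero A ≤ I) {S : FinAct H} (hS : I.mem H S)
    {s t : S.carrier} (hst : s ≠ t) (ht : stab S t = H) {K : Subgroup G} (hK : K ≤ H)
    (hs : stab S s = K) : I.mem H ((orbit hK).sum (FinAct.point H)) := by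
  subst hs
  refine mem_of_injective h0 (X := (orbit hK).sum (FinAct.point H)) _ ?_
    (orbit_sum_point_injective hst ht) hS
  rintro h (z | z)
  · exact orbitMap_smul _ le_rfl h z
  · exact (stab_eq_iff.1 ht h).symm

end WeakIndexingSystem

end Orbits

/-! ### Patterns -/

/-- The pairs of relations on a semilattice of subgroups that describe unital weak indexing systems:
`r K H` says that `[H/K]` is admissible, and `q K H` says that `[H/K] ⊔ *` is admissible. -/
structure IsPattern {α : Type*} [SemilatticeInf α] (r q : α → α → Prop) : Prop where
  le : ∀ {a b}, r a b → a ≤ b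
  refl : ∀ a, r a a
  trans : ∀ {a b c}, r a b → r b c → r a c
  restrict : ∀ {a b c}, r a b → c ≤ b → r (a ⊓ c) c
  rel : ∀ {a b}, q a b → r a b
  restrict_fixed : ∀ {a b c}, q a b → c ≤ b → q (a ⊓ c) c
  trans_fixed : ∀ {a b c}, r a b → q b c → q a c
  fixed_self : ∀ {a b}, r a b → a ≠ b → q a a

theorem IsPattern.comap {α β : Type*} [SemilatticeInf α] [SemilatticeInf β] {r q : α → α → Prop}
    (h : IsPattern r q) (e : β ≃o α) :
    IsPattern (fun a b => r (e a) (e b)) fun a b => q (e a) (e b) where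
  le hab := e.le_iff_le.1 (h.le hab)
  refl _ := h.refl _
  trans := h.trans
  restrict hab hc := by
    rw [e.map_inf]
    exact h.restrict hab (e.le_iff_le.2 hc)
  rel := h.rel
  restrict_fixed hab hc := by
    rw [e.map_inf]
    exact h.restrict_fixed hab (e.le_iff_le.2 hc)
  trans_fixed := h.trans_fixed
  fixed_self hab hne := h.fixed_self hab (e.injective.ne hne)

/-! ### From a pattern to a weak indexing system -/

section Abelian

variable {G : Type u} [CommGroup G] {H : Subgroup G}

theorem map_conj_eq (K : Subgroup G) (g : G) : K.map (MulAut.conj g).toMonoidHom = K := by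
  ext a
  simp [Subgroup.mem_map]

theorem stab_smul (S : FinAct H) (a : H) (s : S.carrier) : stab S (a • s) = stab S s := by
  ext g
  simp only [mem_stab]
  refine exists_congr fun h => ?_
  rw [smul_smul, mul_comm, mul_smul, smul_left_cancel_iff]

/-- Finiteness gives a maximal stabilizer, and the chain condition makes it the greatest, so that
every point considered can be mapped to a point with that stabilizer. -/
theorem exists_max_stab (htot : ∀ K L : Subgroup G, K ≤ L ∨ L ≤ K)
    (S : FinAct H) {P : Set S.carrier} (hP : P.Nonempty) :
    ∃ s ∈ P, ∀ t ∈ P, stab S t ≤ stab S s := by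
  obtain ⟨s, hs, hmax⟩ := P.toFinite.exists_maximalFor (stab S) P hP
  exact ⟨s, hs, fun t ht => (htot (stab S t) (stab S s)).elim id fun h => hmax ht h⟩

theorem conj_mem_of_le {H K : Subgroup G} (h : K ≤ H) : ∀ k ∈ K, (1 : G)⁻¹ * k * 1 ∈ H :=
  fun k hk => by simpa using h hk

theorem stab_restrict {K : Subgroup G} {g : G} (hK : ∀ k ∈ K, g⁻¹ * k * g ∈ H) (S : FinAct H)
    (s : (S.restrict (conjHom g hK)).carrier) :
    stab (S.restrict (conjHom g hK)) s = stab S (FinAct.ofRestrict s) ⊓ K := by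
  have h1 : ∀ (k : G) (hk : k ∈ K) (hk' : k ∈ H), conjHom g hK ⟨k, hk⟩ = ⟨k, hk'⟩ :=
    fun k hk hk' => Subtype.ext (by simp [conjHom])
  have h2 : ∀ k ∈ K, k ∈ H := fun k hk => by simpa using hK k hk
  ext k
  simp only [Subgroup.mem_inf, mem_stab, ← FinAct.ofRestrict_injective.eq_iff,
    FinAct.ofRestrict_smul]
  refine ⟨fun ⟨hk, h⟩ => ⟨⟨h2 k hk, ?_⟩, hk⟩, fun ⟨⟨h, hs⟩, hk⟩ => ⟨hk, ?_⟩⟩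
  · rwa [← h1 k hk]
  · rwa [h1 k hk h]

variable [Finite G]

theorem stab_orbit {K : Subgroup G} (hK : K ≤ H) (z : (orbit hK).carrier) :
    stab (orbit hK) z = K := by
  obtain ⟨a, rfl⟩ := orbit.exists_rep z
  rw [← mul_one a, ← orbit.smul_mk, stab_smul, stab_orbit_one]

namespace WeakIndexingSystem

/-- The unital weak indexing system with a given pattern. -/
def ofPattern {r q : Subgroup G → Subgroup G → Prop} (h : IsPattern r q) :
    WeakIndexingSystem (⊤ : Subgroup G) where
  mem H S := (∀ s, r (stab S s) H) ∧ ∀ s t, s ≠ t → stab S t = H → q (stab S s) H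
  le_of_mem _ := le_top
  iso_mem := by
    rintro H S T ⟨e, he⟩ ⟨h1, h2⟩
    have key : ∀ s, stab T (e s) = stab S s := stab_eq_of_injective he e.injective
    refine ⟨fun t => ?_, fun t t' htt' ht' => ?_⟩
    · obtain ⟨s, rfl⟩ := e.surjective t
      rw [key]
      exact h1 s
    · obtain ⟨s, rfl⟩ := e.surjective t
      obtain ⟨s', rfl⟩ := e.surjective t'
      rw [key] at ht' ⊢
      exact h2 s s' (fun hs => htt' (congrArg e hs)) ht'
  restrict_mem := by
    rintro H K g - hK S ⟨h1, h2⟩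
    have hKH : K ≤ H := fun k hk => by simpa using hK k hk
    refine ⟨fun s => ?_, fun s t hst ht => ?_⟩
    · rw [stab_restrict]
      exact h.restrict (h1 s) hKH
    · rw [stab_restrict] at ht ⊢
      by_cases htH : stab S (FinAct.ofRestrict t) = H
      · exact h.restrict_fixed (h2 _ _ (FinAct.ofRestrict_injective.ne hst) htH) hKH
      · have h3 := h.trans_fixed (h.restrict (h1 (FinAct.ofRestrict s)) (stab_le S _))
          (h.fixed_self (h1 _) htH)
        have h4 := h.restrict_fixed h3 (inf_eq_right.1 ht)
        rwa [inf_assoc, ht] at h4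
  point_mem := fun _ => ⟨fun s => (stab_point s).symm ▸ h.refl _, fun _ _ hst => (hst rfl).elim⟩
  coprod_mem := by
    rintro H ι _ K hK T ⟨h1, h2⟩ hT
    have h1 : ∀ i, r (K i) H := fun i => by
      simpa only [stab_coprod_orbit] using h1 (FinAct.coprod.mk _ i (orbit.mk (hK i) 1))
    refine ⟨?_, ?_⟩
    · rintro ⟨i, z⟩
      obtain ⟨a, t, rfl⟩ := ind.exists_rep z
      have := h.trans ((hT i).1 t) (h1 i)
      rwa [← map_conj_eq (stab (T i) t) a, ← stab_coprod_ind hK T i a t] at this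
    · rintro ⟨i, z⟩ ⟨j, z'⟩ hne hj
      obtain ⟨a, s, rfl⟩ := ind.exists_rep z
      obtain ⟨b, t, rfl⟩ := ind.exists_rep z'
      have hj := (stab_coprod_ind hK T j b t).symm.trans hj
      rw [map_conj_eq] at hj
      -- A fixed point of an induced set forces the induction to be along the identity.
      have hKj : K j = H := le_antisymm (hK j) (hj.symm.le.trans (stab_le _ t))
      suffices h3 : q (stab (T i) s) H by
        rwa [← map_conj_eq (stab (T i) s) a, ← stab_coprod_ind hK T i a s] at h3
      by_cases hij : i = j
      · subst hij
        -- If `s = t`, then this point is fixed by `K i = H`, so the two classes in the induced set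
        -- coincide, contrary to `hne`.
        by_cases hst : s = t
        · subst hst
          refine (hne (congrArg (Sigma.mk i) ((ind.mk_eq_iff _ _ _ _ _ _).2
            ⟨⟨(b : G)⁻¹ * a, ?_⟩, ?_, ?_⟩))).elim
          · rw [hKj]
            exact H.mul_mem (H.inv_mem b.2) a.2
          · ext; simp
          · exact (stab_eq_iff.1 (hj.trans hKj.symm) _).symm
        · have := (hT i).2 s t hst (hj.trans hKj.symm)
          exact (congrArg (q _) hKj).mp this
      · refine h.trans_fixed ((hT i).1 s) ?_
        have := h2 (FinAct.coprod.mk _ i (orbit.mk (hK i) 1))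
          (FinAct.coprod.mk _ j (orbit.mk (hK j) 1)) (fun he => hij (congrArg Sigma.fst he))
        rw [stab_coprod_orbit, stab_coprod_orbit] at this
        exact this hKj

section OfPattern

variable {r q : Subgroup G → Subgroup G → Prop} (h : IsPattern r q)

theorem zero_le_ofPattern : zero ⊤ ≤ ofPattern h := fun H S ⟨_, hS⟩ => by
  refine ⟨fun s => ?_, fun s t hst => (hst (hS.elim s t)).elim⟩
  rw [stab_eq_iff.2 fun a => hS.elim (a • s) s]
  exact h.refl H

theorem orbit_mem_ofPattern {K : Subgroup G} (hK : K ≤ H) :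
    (ofPattern h).mem H (orbit hK) ↔ r K H := by
  refine ⟨fun hm => stab_orbit_one hK ▸ hm.1 (orbit.mk hK 1), fun hr => ⟨fun s => ?_, ?_⟩⟩
  · rwa [stab_orbit]
  · intro s t hst ht
    obtain ⟨a, rfl⟩ := orbit.exists_rep s
    obtain ⟨b, rfl⟩ := orbit.exists_rep t
    rw [stab_orbit] at ht
    exact (hst ((orbit.mk_eq_iff hK a b).2 (ht ▸ H.mul_mem (H.inv_mem a.2) b.2))).elim

theorem orbit_sum_point_mem_ofPattern {K : Subgroup G} (hK : K ≤ H) :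
    (ofPattern h).mem H ((orbit hK).sum (FinAct.point H)) ↔ q K H := by
  constructor
  · intro hm
    have := hm.2 _ _ (FinAct.inl_ne_inr (orbit.mk hK 1) (FinAct.star H))
    rw [stab_inl, stab_inr, stab_point, stab_orbit] at this
    exact this rfl
  · intro hq
    refine ⟨fun s => ?_, fun s t hst ht => ?_⟩
    · obtain ⟨s, rfl⟩ | ⟨s, rfl⟩ := FinAct.eq_inl_or_inr s
      · rw [stab_inl, stab_orbit]
        exact h.rel hq
      · rw [stab_inr, stab_point]
        exact h.refl H
    · obtain ⟨s, rfl⟩ | ⟨s, rfl⟩ := FinAct.eq_inl_or_inr s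
      · rwa [stab_inl, stab_orbit]
      · obtain ⟨t, rfl⟩ | ⟨t, rfl⟩ := FinAct.eq_inl_or_inr t
        · rw [stab_inl, stab_orbit] at ht
          rw [stab_inr, stab_point]
          subst ht
          exact hq
        · exact (hst rfl).elim

/-- The diagonal case of the pointed test, since `[H/H]` is a point. -/
theorem two_points_mem_ofPattern :
    (ofPattern h).mem H ((FinAct.point H).sum (FinAct.point H)) ↔ q H H := by
  rw [← orbit_sum_point_mem_ofPattern h le_rfl]
  have : Subsingleton (orbit (le_refl H)).carrier := ⟨fun z z' => by
    obtain ⟨a, rfl⟩ := orbit.exists_rep z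
    obtain ⟨b, rfl⟩ := orbit.exists_rep z'
    exact (orbit.mk_eq_iff _ a b).2 (H.mul_mem (H.inv_mem a.2) b.2)⟩
  have hiso : ((FinAct.point H).sum (FinAct.point H)).Iso
      ((orbit (le_refl H)).sum (FinAct.point H)) := by
    let e : PUnit.{u + 1} ≃ (orbit (le_refl H)).carrier :=
      ⟨fun _ => orbit.mk le_rfl 1, fun _ => PUnit.unit, fun _ => rfl, fun _ => this.elim _ _⟩
    refine ⟨e.sumCongr (Equiv.refl PUnit.{u + 1}), ?_⟩
    rintro a (s | s)
    · exact congrArg Sum.inl (this.elim _ _)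
    · rfl
  exact ⟨(ofPattern h).iso_mem hiso, (ofPattern h).iso_mem hiso.symm⟩

/-- Both relations are recovered by testing the sets `[H/K]` and `[H/K] ⊔ *`, so passing to systems
loses no order information. -/
theorem ofPattern_le_ofPattern {r' q' : Subgroup G → Subgroup G → Prop} (h' : IsPattern r' q') :
    ofPattern h ≤ ofPattern h' ↔ (∀ K H, r K H → r' K H) ∧ ∀ K H, q K H → q' K H := by
  constructor
  · intro hle
    refine ⟨fun K H hr => ?_, fun K H hq => ?_⟩
    · exact (orbit_mem_ofPattern h' (h.le hr)).1 (hle _ _ ((orbit_mem_ofPattern h (h.le hr)).2 hr))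
    · have hK := h.le (h.rel hq)
      exact (orbit_sum_point_mem_ofPattern h' hK).1
        (hle _ _ ((orbit_sum_point_mem_ofPattern h hK).2 hq))
  · rintro ⟨h1, h2⟩ H S ⟨h3, h4⟩
    exact ⟨fun s => h1 _ _ (h3 s), fun s t hst ht => h2 _ _ (h4 s t hst ht)⟩

end OfPattern

end WeakIndexingSystem

end Abelian

/-! ### Recovering a unital system from its pattern -/

section Characterization

variable {G : Type u} [CommGroup G] [Finite G]

namespace WeakIndexingSystem

variable {A : Subgroup G}

/-- The transfers of a weak indexing system. -/
def Transfer (I : WeakIndexingSystem A) (K H : Subgroup G) : Prop :=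
  ∃ hK : K ≤ H, I.mem H (orbit hK)

/-- The pairs `K ≤ H` such that `[H/K] ⊔ *` is admissible. -/
def PointedTransfer (I : WeakIndexingSystem A) (K H : Subgroup G) : Prop :=
  ∃ hK : K ≤ H, I.mem H ((orbit hK).sum (FinAct.point H))

theorem transfer_of_mem {I : WeakIndexingSystem A} (h0 : zero A ≤ I) {H : Subgroup G} {S : FinAct H}
    (hS : I.mem H S) (s : S.carrier) : I.Transfer (stab S s) H :=
  ⟨stab_le S s, orbit_mem_of_mem h0 hS _ rfl⟩

theorem pointedTransfer_of_mem {I : WeakIndexingSystem A} (h0 : zero A ≤ I) {H : Subgroup G}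
    {S : FinAct H} (hS : I.mem H S) {s t : S.carrier} (hst : s ≠ t) (ht : stab S t = H) :
    I.PointedTransfer (stab S s) H :=
  ⟨stab_le S s, orbit_sum_point_mem_of_mem h0 hS hst ht _ rfl⟩

variable {I : WeakIndexingSystem (⊤ : Subgroup G)}

theorem point_mem_of_zero_le (h0 : zero ⊤ ≤ I) (H : Subgroup G) : I.mem H (FinAct.point H) :=
  h0 _ _ ⟨le_top, inferInstanceAs (Subsingleton PUnit)⟩

theorem mem_of_subsingleton (h0 : zero ⊤ ≤ I) {H : Subgroup G} (S : FinAct H)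
    (hS : Subsingleton S.carrier) : I.mem H S := h0 _ _ ⟨le_top, hS⟩

/-- Inducing `[K/J]` up to `H` yields `[H/J]`; this is a self-indexed coproduct over a single orbit.
-/
theorem Transfer.trans (h0 : zero ⊤ ≤ I) {J K H : Subgroup G} (hJK : I.Transfer J K)
    (hKH : I.Transfer K H) : I.Transfer J H := by
  obtain ⟨hJ, hJ'⟩ := hJK
  obtain ⟨hK, hK'⟩ := hKH
  have h1 : I.mem H (FinAct.coprod fun _ : Unit => orbit hK) := I.iso_mem
    ⟨(Equiv.uniqueSigma fun _ : Unit => (orbit hK).carrier).symm, fun _ _ => rfl⟩ hK'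
  have h2 := transfer_of_mem h0 (I.coprod_mem (fun _ : Unit => hK) (fun _ => orbit hJ) h1
    fun _ => hJ') (FinAct.coprod.mk _ () (ind.mk hK (orbit hJ) 1 (orbit.mk hJ 1)))
  rwa [stab_coprod_ind (fun _ : Unit => hK) (fun _ => orbit hJ), map_conj_eq, stab_orbit] at h2

theorem PointedTransfer.trans (h0 : zero ⊤ ≤ I) {J K H : Subgroup G} (hJK : I.Transfer J K)
    (hKH : I.PointedTransfer K H) : I.PointedTransfer J H := by
  obtain ⟨hJ, hJ'⟩ := hJK
  obtain ⟨hK, hK'⟩ := hKH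
  -- Index `[H/K] ⊔ *` by two summands: `[K/J]` is induced along `K ≤ H` on one, and the point is
  -- kept on the other.
  let L : Bool → Subgroup G := fun b => cond b K H
  have hL : ∀ b, L b ≤ H := fun b => match b with
    | true => hK
    | false => le_rfl
  let T : ∀ b, FinAct (L b) := fun b => match b with
    | true => orbit hJ
    | false => FinAct.point H
  have hT : ∀ b, I.mem (L b) (T b) := fun b => match b with
    | true => hJ'
    | false => point_mem_of_zero_le h0 H
  let f : (Σ b, (orbit (hL b)).carrier) → ((orbit hK).sum (FinAct.point H)).carrier := fun z =>
    match z with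
    | ⟨true, z⟩ => (orbit hK).inl (FinAct.point H) z
    | ⟨false, _⟩ => (orbit hK).inr (FinAct.point H) (FinAct.star H)
  have hf : ∀ (h : H) (z : (FinAct.coprod fun b => orbit (hL b)).carrier), f (h • z) = h • f z := by
    rintro h ⟨_ | _, z⟩ <;> rfl
  have hfi : Function.Injective f := by
    rintro ⟨_ | _, z⟩ ⟨_ | _, z'⟩ hz
    · obtain ⟨a, rfl⟩ := orbit.exists_rep z
      obtain ⟨b, rfl⟩ := orbit.exists_rep z'
      exact congrArg (Sigma.mk false)
        ((orbit.mk_eq_iff _ a b).2 (H.mul_mem (H.inv_mem a.2) b.2))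
    · exact (FinAct.inl_ne_inr _ _ hz.symm).elim
    · exact (FinAct.inl_ne_inr _ _ hz).elim
    · exact congrArg (Sigma.mk true) (Sum.inl_injective hz)
  have h1 := mem_of_injective (X := FinAct.coprod fun b => orbit (hL b)) h0 f hf hfi hK'
  have h2 := pointedTransfer_of_mem h0 (I.coprod_mem hL T h1 hT)
    (s := FinAct.coprod.mk _ true (ind.mk hK (orbit hJ) 1 (orbit.mk hJ 1)))
    (t := FinAct.coprod.mk _ false (ind.mk le_rfl (FinAct.point H) 1 (FinAct.star H)))
    (fun h => Bool.noConfusion (congrArg Sigma.fst h))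
    ((stab_coprod_ind hL T false 1 (FinAct.star H)).trans ((map_conj_eq _ _).trans (stab_point _)))
  rwa [stab_coprod_ind hL T true 1 (orbit.mk hJ 1), map_conj_eq, stab_orbit] at h2

/-- The transfers and pointed transfers of a unital weak indexing system form a pattern. -/
theorem isPattern (h0 : zero ⊤ ≤ I) : IsPattern I.Transfer I.PointedTransfer where
  le h := h.1
  refl H := by
    simpa only [stab_point] using transfer_of_mem h0 (point_mem_of_zero_le h0 H) (FinAct.star H)
  trans := Transfer.trans h0
  restrict := by
    rintro K H L ⟨hK, hK'⟩ hL
    have := transfer_of_mem h0 (I.restrict_mem (Subgroup.mem_top 1) (conj_mem_of_le hL) hK')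
      (FinAct.toRestrict _ (orbit.mk hK 1))
    rwa [stab_restrict, stab_orbit] at this
  rel := by
    rintro K H ⟨hK, hK'⟩
    have := transfer_of_mem h0 hK' ((orbit hK).inl _ (orbit.mk hK 1))
    rwa [stab_inl, stab_orbit] at this
  restrict_fixed := by
    rintro K H L ⟨hK, hK'⟩ hL
    have := pointedTransfer_of_mem h0
      (I.restrict_mem (Subgroup.mem_top 1) (conj_mem_of_le hL) hK')
      (s := FinAct.toRestrict _ ((orbit hK).inl _ (orbit.mk hK 1)))
      (t := FinAct.toRestrict _ ((orbit hK).inr _ (FinAct.star H)))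
      ((FinAct.toRestrict_injective _).ne (FinAct.inl_ne_inr _ _)) (by
        rw [stab_restrict, FinAct.ofRestrict_toRestrict, stab_inr, stab_point]
        exact inf_eq_right.2 hL)
    rwa [stab_restrict, FinAct.ofRestrict_toRestrict, stab_inl, stab_orbit] at this
  trans_fixed := PointedTransfer.trans h0
  fixed_self := by
    rintro K H ⟨hK, hK'⟩ hne
    -- By commutativity `K` acts trivially on `[H/K]`. Since `K` is proper, the cosets of `1` and
    -- `g` are two distinct fixed points of the restriction to `K`.
    obtain ⟨g, hg, hgK⟩ := SetLike.exists_of_lt (lt_of_le_of_ne hK hne)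
    have hst : ∀ z : ((orbit hK).restrict (conjHom 1 (conj_mem_of_le hK))).carrier,
        stab _ z = K := fun z => by
      rw [stab_restrict, stab_orbit, inf_idem]
    have := pointedTransfer_of_mem h0
      (I.restrict_mem (Subgroup.mem_top 1) (conj_mem_of_le hK) hK')
      (s := FinAct.toRestrict _ (orbit.mk hK 1)) (t := FinAct.toRestrict _ (orbit.mk hK ⟨g, hg⟩))
      (fun h => hgK (by simpa using (orbit.mk_eq_iff hK _ _).1 h)) (hst _)
    rwa [hst] at this

/-- Admissibility of `H`-sets can be read off from their stabilizers. -/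
def Determines (I : WeakIndexingSystem A) (H : Subgroup G) : Prop :=
  ∀ S : FinAct H, (∀ s, I.Transfer (stab S s) H) →
    (∀ s t, s ≠ t → stab S t = H → I.PointedTransfer (stab S s) H) → I.mem H S

/-- Fibers over points with smaller stabilizers are admissible. -/
theorem fiber_mem (h0 : zero ⊤ ≤ I) {H : Subgroup G} (ih : ∀ K < H, I.Determines K)
    {S M : FinAct H} (f : S.carrier → M.carrier)
    (hf : ∀ (h : H) (x : S.carrier), f (h • x) = h • f x) (hS : ∀ s, I.Transfer (stab S s) H)
    {z : M.carrier} (hz : stab M z ≠ H) (hM : I.Transfer (stab M z) H) :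
    I.mem (stab M z) (fiber f hf z) := by
  have hp := isPattern h0
  have key : ∀ x : (fiber f hf z).carrier, I.Transfer (stab (fiber f hf z) x) (stab M z) :=
    fun x => by
      have := hp.restrict (hS x.1) (stab_le M z)
      rw [← stab_fiber f hf z x] at this
      rwa [inf_eq_left.2 (stab_le _ x)] at this
  -- Over the proper subgroup `stab M z` the pointed condition is automatic: `fixed_self` makes two
  -- points admissible, and inducing into one of them gives every pointed transfer required.
  exact ih _ (lt_of_le_of_ne (stab_le M z) hz) _ key
    fun s _ _ _ => hp.trans_fixed (key s) (hp.fixed_self hM hz)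

/-- A set without fixed points, all of whose orbits are admissible, is admissible: it maps to one of
its orbits of maximal stabilizer. -/
theorem mem_of_forall_stab_ne (h0 : zero ⊤ ≤ I) (htot : ∀ K L : Subgroup G, K ≤ L ∨ L ≤ K)
    {H : Subgroup G} (ih : ∀ K < H, I.Determines K) (S : FinAct H)
    (hS : ∀ s, I.Transfer (stab S s) H) (hne : ∀ s, stab S s ≠ H) : I.mem H S := by
  rcases isEmpty_or_nonempty S.carrier with he | he
  · exact mem_of_subsingleton h0 S inferInstance
  obtain ⟨s₀, -, hs₀⟩ := exists_max_stab htot S Set.univ_nonempty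
  obtain ⟨f, hf, -⟩ := exists_equivariant (S := orbit (stab_le S s₀))
    (fun _ : S.carrier => orbit.mk (stab_le S s₀) 1)
    (fun x => (hs₀ x trivial).trans (stab_orbit _ _).ge)
  refine mem_of_fiber f hf (hS s₀).2 fun z => ⟨1, fiber_mem h0 ih f hf hS ?_ ?_⟩
  · rw [stab_orbit]
    exact hne s₀
  · rw [stab_orbit]
    exact hS s₀

/-- Admissibility over `H` can be read off from stabilizers if this holds over smaller subgroups; the
proof is by induction on the number of points. -/
theorem determines_of_forall_lt (h0 : zero ⊤ ≤ I) (htot : ∀ K L : Subgroup G, K ≤ L ∨ L ≤ K)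
    {H : Subgroup G} (ih : ∀ K < H, I.Determines K) (n : ℕ) :
    ∀ (L : Subgroup G) (_ : L = H) (S : FinAct L), Nat.card S.carrier = n →
      (∀ s, I.Transfer (stab S s) L) →
      (∀ s t, s ≠ t → stab S t = L → I.PointedTransfer (stab S s) L) → I.mem L S := by
  have hp := isPattern h0
  induction n using Nat.strong_induction_on with
  | _ n ihn =>
  rintro L rfl S hn h1 h2
  by_cases hfix : ∃ t, stab S t = L
  swap
  · exact mem_of_forall_stab_ne h0 htot ih S h1 fun s hs => hfix ⟨s, hs⟩
  obtain ⟨t, ht⟩ := hfix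
  by_cases htwo : ∃ t', t ≠ t' ∧ stab S t' = L
  · obtain ⟨t', hne, ht'⟩ := htwo
    have hq := h2 t t' hne ht'
    rw [ht] at hq
    classical
    obtain ⟨hLL, hM⟩ := hq
    -- With two fixed points, `2 · *_L` is admissible. The map isolates `t`; the other fiber is `S`
    -- without `t`, to which the induction on cardinality applies.
    let f : S.carrier → ((orbit hLL).sum (FinAct.point L)).carrier := fun x =>
      if x = t then (orbit hLL).inr _ (FinAct.star L) else (orbit hLL).inl _ (orbit.mk hLL 1)
    have hsub : ∀ z z' : (orbit hLL).carrier, z = z' := fun z z' => by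
      obtain ⟨a, rfl⟩ := orbit.exists_rep z
      obtain ⟨b, rfl⟩ := orbit.exists_rep z'
      exact (orbit.mk_eq_iff _ a b).2 (L.mul_mem (L.inv_mem a.2) b.2)
    have hf : ∀ (h : L) (x : S.carrier), f (h • x) = h • f x := fun h x => by
      have hx : h • x = t ↔ x = t := by
        conv_lhs => rw [← stab_eq_iff.1 ht h, smul_left_cancel_iff]
      simp only [f, hx]
      split_ifs
      · rfl
      · exact congrArg ((orbit hLL).inl _) (hsub _ _)
    refine mem_of_fiber f hf hM fun z => ⟨1, ?_⟩
    rw [one_smul]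
    obtain ⟨z, rfl⟩ | ⟨z, rfl⟩ := FinAct.eq_inl_or_inr z
    · have hst : stab _ ((orbit hLL).inl (FinAct.point L) z) = L :=
        (stab_inl _).trans (stab_orbit _ _)
      -- This fiber is a set over a stabilizer that equals `L` only propositionally, which is why
      -- the induction ranges over all subgroups equal to `H`.
      refine ihn _ ?_ _ hst (fiber f hf _) rfl (fun x => ?_) fun x y hxy hy => ?_
      · rw [← hn]
        refine Finite.card_subtype_lt (x := t) ?_
        simp only [f, if_pos]
        exact (FinAct.inl_ne_inr _ _).symm
      · rw [stab_fiber f hf _ x, hst]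
        exact h1 _
      · rw [stab_fiber f hf _ x, hst]
        rw [stab_fiber f hf _ y, hst] at hy
        exact h2 _ _ (fun h => hxy (Subtype.ext h)) hy
    · refine mem_of_subsingleton h0 _ ⟨fun x y => Subtype.ext ?_⟩
      have key : ∀ x : S.carrier, f x = (orbit hLL).inr _ z → x = t := fun x hx => by
        by_contra hxt
        simp only [f, if_neg hxt] at hx
        exact FinAct.inl_ne_inr _ _ hx
      exact (key _ x.2).trans (key _ y.2).symm
  · have huniq : ∀ t', stab S t' = L → t' = t := fun t' h => by
      by_contra hne
      exact htwo ⟨t', fun h' => hne h'.symm, h⟩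
    rcases Set.eq_empty_or_nonempty {s | stab S s ≠ L} with he | he
    · refine mem_of_subsingleton h0 S ⟨fun x y => ?_⟩
      have key : ∀ x, stab S x = L := fun x => by
        by_contra hx
        exact Set.notMem_empty x (he ▸ hx)
      exact (huniq x (key x)).trans (huniq y (key y)).symm
    obtain ⟨s₀, hs₀, hmax⟩ := exists_max_stab htot S he
    obtain ⟨hK, hM⟩ := h2 s₀ t (fun h => hs₀ (h ▸ ht)) ht
    classical
    -- With `t` the only fixed point, send it to `*` and everything else to `[L/K]`, where `K` is
    -- the greatest proper stabilizer.
    obtain ⟨f, hf, hfg⟩ := exists_equivariant (S := (orbit hK).sum (FinAct.point L))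
      (fun x : S.carrier => if stab S x = L then (orbit hK).inr _ (FinAct.star L)
        else (orbit hK).inl _ (orbit.mk hK 1)) (fun x => by
        split_ifs with hx
        · rw [stab_inr, stab_point]
          exact stab_le S x
        · rw [stab_inl, stab_orbit]
          exact hmax x hx)
    refine mem_of_fiber f hf hM fun z => ⟨1, ?_⟩
    rw [one_smul]
    obtain ⟨z, rfl⟩ | ⟨z, rfl⟩ := FinAct.eq_inl_or_inr z
    · have hst : stab _ ((orbit hK).inl (FinAct.point L) z) = stab S s₀ :=
        (stab_inl _).trans (stab_orbit _ _)
      exact fiber_mem h0 ih f hf h1 (hst.trans_ne hs₀) (hst.symm ▸ h1 s₀)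
    · refine mem_of_subsingleton h0 _ ⟨fun x y => Subtype.ext ?_⟩
      have key : ∀ x : S.carrier, f x = (orbit hK).inr _ z → x = t := fun x hx => by
        -- The map agrees with the prescription only up to translation from a representative `y`; a
        -- point over `*` is thus a translate of a fixed point, necessarily `t`.
        obtain ⟨h, y, rfl, hy⟩ := hfg x
        rw [hx] at hy
        split_ifs at hy with hyL
        · rw [huniq y hyL]
          exact stab_eq_iff.1 ht h
        · rw [FinAct.smul_inl] at hy
          exact (FinAct.inl_ne_inr _ _ hy.symm).elim
      exact (key _ x.2).trans (key _ y.2).symm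

/-- A unital weak indexing system over a group whose subgroups form a chain is determined by its
pattern. -/
theorem eq_ofPattern (h0 : zero ⊤ ≤ I) (htot : ∀ K L : Subgroup G, K ≤ L ∨ L ≤ K) :
    I = ofPattern (isPattern h0) := by
  refine le_antisymm (fun H S hS => ⟨transfer_of_mem h0 hS,
    fun s t hst ht => pointedTransfer_of_mem h0 hS hst ht⟩) fun H => ?_
  have key : I.Determines H := by
    induction H using WellFoundedLT.induction with
    | _ H ih => exact fun S => determines_of_forall_lt h0 htot ih _ H rfl S rfl
  exact fun S hS => key S hS.1 hS.2

end WeakIndexingSystem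

end Characterization

/-! ### Patterns on a chain of three subgroups -/

namespace Vertex

/-- The nontrivial transfers of a vertex; the subgroups are numbered in increasing order. -/
def transfers : Vertex → List (Fin 3 × Fin 3)
  | zero | foldE | foldC | foldG => []
  | bar1 | ext1 | foldCBar1 | full1 => [(0, 1)]
  | bar2 | disk2 | full2 => [(1, 2)]
  | bar3 | ext3 | disk3 | foldCBar3 | foldCDisk3 | full3 => [(0, 1), (0, 2)]
  | bar4 | barDisk | diskSum | full4 => [(0, 1), (0, 2), (1, 2)]

/-- The pairs `K ≤ H` for which a vertex contains `[H/K] ⊔ *`. -/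
def pointedTransfers : Vertex → List (Fin 3 × Fin 3)
  | zero => []
  | foldE | bar1 | bar3 => [(0, 0)]
  | ext1 | ext3 => [(0, 0), (0, 1)]
  | disk3 => [(0, 0), (0, 1), (0, 2)]
  | foldC | bar2 => [(0, 0), (1, 1)]
  | foldCBar1 | foldCBar3 | bar4 => [(0, 0), (1, 1), (0, 1)]
  | foldCDisk3 | barDisk => [(0, 0), (1, 1), (0, 1), (0, 2)]
  | disk2 => [(0, 0), (1, 1), (1, 2)]
  | diskSum => [(0, 0), (1, 1), (0, 1), (0, 2), (1, 2)]
  | foldG => [(0, 0), (1, 1), (2, 2)]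
  | full1 => [(0, 0), (1, 1), (2, 2), (0, 1)]
  | full2 => [(0, 0), (1, 1), (2, 2), (1, 2)]
  | full3 => [(0, 0), (1, 1), (2, 2), (0, 1), (0, 2)]
  | full4 => [(0, 0), (1, 1), (2, 2), (0, 1), (0, 2), (1, 2)]

instance : Fintype Vertex where
  elems := ⟨[zero, foldE, bar1, bar3, ext1, ext3, disk3, foldC, foldCBar1, bar2, foldCBar3, bar4,
    foldCDisk3, barDisk, disk2, diskSum, foldG, full1, full2, full3, full4], by decide⟩
  complete a := by cases a <;> decide

theorem card : Fintype.card Vertex = 21 := rfl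

/-- The first half of the pattern of a vertex. -/
def Rel (a : Vertex) (i j : Fin 3) : Prop := i = j ∨ (i, j) ∈ a.transfers

/-- The second half of the pattern of a vertex. -/
def PointedRel (a : Vertex) (i j : Fin 3) : Prop := (i, j) ∈ a.pointedTransfers

instance (a : Vertex) (i j : Fin 3) : Decidable (a.Rel i j) :=
  inferInstanceAs (Decidable (_ ∨ _))

instance (a : Vertex) (i j : Fin 3) : Decidable (a.PointedRel i j) :=
  inferInstanceAs (Decidable (_ ∈ _))

instance : LE Vertex where
  le a b := (∀ i j, a.Rel i j → b.Rel i j) ∧ ∀ i j, a.PointedRel i j → b.PointedRel i j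

instance (a b : Vertex) : Decidable (a ≤ b) := inferInstanceAs (Decidable (_ ∧ _))

instance : PartialOrder Vertex where
  le_refl _ := ⟨fun _ _ => id, fun _ _ => id⟩
  le_trans _ _ _ h h' :=
    ⟨fun i j hij => h'.1 i j (h.1 i j hij), fun i j hij => h'.2 i j (h.2 i j hij)⟩
  le_antisymm := by decide

theorem isPattern : ∀ a : Vertex, IsPattern a.Rel a.PointedRel := fun a =>
  { le := by revert a; decide
    refl := fun _ => Or.inl rfl
    trans := by revert a; decide
    restrict := by revert a; decide
    rel := by revert a; decide
    restrict_fixed := by revert a; decide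
    trans_fixed := by revert a; decide
    fixed_self := by revert a; decide }

/-- Expressing the covering relation through `≤` and `≠` turns it into a decidable statement on 21
elements. -/
theorem covBy_iff (a b : Vertex) : a ⋖ b ↔ (a, b) ∈ arrows := by
  have h : ∀ a b : Vertex, ((a ≤ b ∧ a ≠ b) ∧ ∀ c, a ≤ c → a ≠ c → c ≤ b → c = b) ↔
    (a, b) ∈ arrows := by decide
  rw [← h, CovBy, lt_iff_le_and_ne]
  refine and_congr_right fun _ => ⟨fun h c h1 h2 h3 => ?_, fun h c h1 h2 => h2.ne ?_⟩
  · by_contra h4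
    exact h (lt_of_le_of_ne h1 h2) (lt_of_le_of_ne h3 h4)
  · exact h c h1.le h1.ne h2.le

end Vertex

/-! ### Enumeration of the patterns -/

namespace Vertex

/-- In a locally finite order, and hence in a finite one, `≤` is generated by the covering
relations. -/
theorem le_iff_reflTransGen (a b : Vertex) :
    a ≤ b ↔ Relation.ReflTransGen (fun c d => (c, d) ∈ arrows) a b := by
  classical
  let _ : LocallyFiniteOrder Vertex := Fintype.toLocallyFiniteOrder
  rw [le_iff_reflTransGen_covBy]
  simp only [covBy_iff]

/-- The values of a pattern on `Fin 3` that are not determined by its being a pattern. -/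
def code (a : Vertex) : (Bool × Bool × Bool) × (Bool × Bool × Bool) × Bool × Bool × Bool :=
  ((a.Rel 0 1, a.Rel 0 2, a.Rel 1 2), (a.PointedRel 0 0, a.PointedRel 1 1, a.PointedRel 2 2),
    a.PointedRel 0 1, a.PointedRel 0 2, a.PointedRel 1 2)

/-- The conditions on the values of a pattern on `Fin 3`. -/
def Consistent (r01 r02 r12 q00 q11 q22 q01 q02 q12 : Bool) : Prop :=
  (q01 → r01) ∧ (q02 → r02) ∧ (q12 → r12) ∧ (r02 → r01) ∧ (r01 → q00) ∧ (r12 → q11) ∧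
    (q11 → q00) ∧ (q22 → q11) ∧ (q02 → q01) ∧ (r01 → r12 → r02) ∧ (r01 → q11 → q01) ∧
    (r01 → q12 → q02) ∧ (r02 → q22 → q02) ∧ (r12 → q22 → q12)

instance (r01 r02 r12 q00 q11 q22 q01 q02 q12 : Bool) :
    Decidable (Consistent r01 r02 r12 q00 q11 q22 q01 q02 q12) :=
  inferInstanceAs (Decidable (_ ∧ _))

/-- The completeness half of the count, by checking all 512 assignments. Distinctness of the 21
patterns is the antisymmetry of the order on `Vertex`. -/
theorem exists_code : ∀ r01 r02 r12 q00 q11 q22 q01 q02 q12 : Bool,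
    ¬ Consistent r01 r02 r12 q00 q11 q22 q01 q02 q12 ∨
      ∃ a : Vertex, a.code = ((r01, r02, r12), (q00, q11, q22), q01, q02, q12) := by
  decide

theorem exists_of_isPattern {r q : Fin 3 → Fin 3 → Prop} (h : IsPattern r q) :
    ∃ a : Vertex, (∀ i j, a.Rel i j ↔ r i j) ∧ ∀ i j, a.PointedRel i j ↔ q i j := by
  classical
  obtain ⟨a, ha⟩ := (exists_code (decide (r 0 1)) (decide (r 0 2)) (decide (r 1 2))
    (decide (q 0 0)) (decide (q 1 1)) (decide (q 2 2)) (decide (q 0 1))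
    (decide (q 0 2)) (decide (q 1 2))).resolve_left (not_not_intro (by
      simp only [Consistent, decide_eq_true_eq]
      exact ⟨h.rel, h.rel, h.rel, fun h' => h.restrict h' (by decide : (1 : Fin 3) ≤ 2),
        fun h' => h.fixed_self h' (by decide), fun h' => h.fixed_self h' (by decide),
        fun h' => h.restrict_fixed h' (by decide : (0 : Fin 3) ≤ 1),
        fun h' => h.restrict_fixed h' (by decide : (1 : Fin 3) ≤ 2),
        fun h' => h.restrict_fixed h' (by decide : (1 : Fin 3) ≤ 2),
        h.trans, h.trans_fixed, h.trans_fixed, h.trans_fixed, h.trans_fixed⟩))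
  simp only [code, Prod.mk.injEq, decide_eq_decide] at ha
  obtain ⟨⟨h1, h2, h3⟩, ⟨h4, h5, h6⟩, h7, h8, h9⟩ := ha
  -- The remaining values are forced: `r` holds on the diagonal, and both relations fail when the
  -- first index is larger.
  have hr : ∀ {i j}, j < i → ¬ r i j := fun hij h' => (h.le h').not_gt hij
  have hq : ∀ {i j}, j < i → ¬ q i j := fun hij h' => hr hij (h.rel h')
  have ha := a.isPattern
  have hr' : ∀ {i j}, j < i → ¬ a.Rel i j := fun hij h' => (ha.le h').not_gt hij
  have hq' : ∀ {i j}, j < i → ¬ a.PointedRel i j := fun hij h' => hr' hij (ha.rel h')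
  refine ⟨a, fun i j => ?_, fun i j => ?_⟩
  · rcases lt_trichotomy i j with hij | rfl | hij
    · fin_cases i <;> fin_cases j <;> first | assumption | exact absurd hij (by decide)
    · exact iff_of_true (ha.refl i) (h.refl i)
    · exact iff_of_false (hr' hij) (hr hij)
  · rcases le_or_gt i j with hij | hij
    · fin_cases i <;> fin_cases j <;> first | assumption | exact absurd hij (by decide)
    · exact iff_of_false (hq' hij) (hq hij)

end Vertex

/-! ### The poset of unital weak indexing systems -/

section Classification

open WeakIndexingSystem

variable {G : Type u} [CommGroup G] [Finite G]

/-- The unital weak indexing system of a vertex, for a numbering of the subgroups of `G`. -/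
def Vertex.system (e : Subgroup G ≃o Fin 3) (a : Vertex) :
    WeakIndexingSystem (⊤ : Subgroup G) := ofPattern (a.isPattern.comap e)

theorem Vertex.zero_le_system (e : Subgroup G ≃o Fin 3) (a : Vertex) :
    WeakIndexingSystem.zero ⊤ ≤ a.system e :=
  zero_le_ofPattern _

theorem Vertex.system_le_system (e : Subgroup G ≃o Fin 3) {a b : Vertex} :
    a.system e ≤ b.system e ↔ a ≤ b := by
  refine (ofPattern_le_ofPattern _ _).trans (and_congr ?_ ?_)
  · exact ⟨fun h i j => by simpa using h (e.symm i) (e.symm j), fun h K H => h _ _⟩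
  · exact ⟨fun h i j => by simpa using h (e.symm i) (e.symm j), fun h K H => h _ _⟩

theorem Vertex.exists_system_eq (e : Subgroup G ≃o Fin 3) {I : WeakIndexingSystem (⊤ : Subgroup G)}
    (h0 : WeakIndexingSystem.zero ⊤ ≤ I) : ∃ a : Vertex, a.system e = I := by
  have htot : ∀ K L : Subgroup G, K ≤ L ∨ L ≤ K := fun K L => by
    rw [← e.le_iff_le, ← e.le_iff_le]
    exact le_total _ _
  obtain ⟨a, hr, hq⟩ := exists_of_isPattern ((WeakIndexingSystem.isPattern h0).comap e.symm)
  refine ⟨a, (le_antisymm ?_ ?_ : ofPattern _ = I)⟩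
  all_goals
    rw [eq_ofPattern h0 htot, ofPattern_le_ofPattern]
    simp [hr, hq]

/-- The classification of unital weak indexing systems. -/
noncomputable def Vertex.systemIso (e : Subgroup G ≃o Fin 3) :
    Vertex ≃o {I : WeakIndexingSystem (⊤ : Subgroup G) // I.IsUnital} :=
  RelIso.ofSurjective
    (OrderEmbedding.ofMapLEIff (fun a => ⟨a.system e, isUnital_iff.2 (a.zero_le_system e)⟩)
      fun _ _ => Vertex.system_le_system e)
    fun I => (Vertex.exists_system_eq e (isUnital_iff.1 I.2)).imp fun _ h => Subtype.ext h

end Classification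

/-! ### Representations -/

section LinearAlgebra

variable {V : Type v} [AddCommGroup V] [Module ℝ V]

theorem sq_eq_one_of_pow_eq_one {c : ℝ} {n : ℕ} (hn : n ≠ 0) (h : c ^ n = 1) : c ^ 2 = 1 := by
  have : |c| = 1 := by
    rw [← pow_eq_one_iff_of_nonneg (abs_nonneg c) hn, ← abs_pow, h, abs_one]
  rw [← sq_abs, this, one_pow]

/-- A linear automorphism of finite order of a real plane with an eigenvector is an involution. -/
theorem sq_eq_one_of_eigenvector (hV : Module.finrank ℝ V = 2) {f : Module.End ℝ V} {n : ℕ}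
    (hn : n ≠ 0) (hf : f ^ n = 1) {v : V} (hv : v ≠ 0) {c : ℝ} (hc : f v = c • v) : f ^ 2 = 1 := by
  obtain ⟨u, hu⟩ :=
    exists_linearIndependent_pair_of_one_lt_finrank (by omega : 1 < Module.finrank ℝ V) hv
  have hpair := LinearIndependent.pair_iff.1 hu
  have : FiniteDimensional ℝ V := Module.finite_of_finrank_pos (by omega)
  have hspan : Submodule.span ℝ {v, u} = ⊤ := by
    have := hu.span_eq_top_of_card_eq_finrank' (by simp [hV])
    simpa [Set.pair_comm v] using this
  have hmem : ∀ w : V, ∃ a b : ℝ, a • v + b • u = w := fun w =>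
    Submodule.mem_span_pair.1 (hspan ▸ Submodule.mem_top)
  -- In the basis `v, u` the map is upper triangular with diagonal entries `c` and `d`, real roots
  -- of unity and hence signs.
  obtain ⟨b, d, hd⟩ := hmem (f u)
  have hpowv : ∀ k : ℕ, (f ^ k) v = c ^ k • v := fun k => by
    induction k with
    | zero => simp
    | succ k ih => rw [pow_succ', Module.End.mul_apply, ih, map_smul, hc, smul_smul, pow_succ]
  have hpowu : ∀ k : ℕ, ∃ a : ℝ, (f ^ k) u = a • v + d ^ k • u := fun k => by
    induction k with
    | zero => exact ⟨0, by simp⟩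
    | succ k ih =>
      obtain ⟨a, ha⟩ := ih
      refine ⟨a * c + d ^ k * b, ?_⟩
      rw [pow_succ', Module.End.mul_apply, ha, map_add, map_smul, map_smul, hc, ← hd]
      module
  have hc2 : c ^ 2 = 1 := by
    refine sq_eq_one_of_pow_eq_one hn ?_
    have := hpowv n
    rw [hf, Module.End.one_apply] at this
    exact smul_left_injective ℝ hv (by simpa using this.symm)
  have hd2 : d ^ 2 = 1 := by
    refine sq_eq_one_of_pow_eq_one hn ?_
    obtain ⟨a, ha⟩ := hpowu n
    rw [hf, Module.End.one_apply] at ha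
    have := (hpair a (d ^ n - 1) (by rw [sub_smul, one_smul, ← add_sub_assoc, ← ha, sub_self])).2
    linarith
  obtain ⟨a, ha⟩ := hpowu 2
  rw [hd2, one_smul] at ha
  have hv2 : (f ^ 2) v = v := by rw [hpowv, hc2, one_smul]
  -- So `f ^ 2` is unipotent with off-diagonal entry `a`; its `n`-th power has entry `n * a`, and
  -- finite order forces `a = 0`.
  have hk : ∀ k : ℕ, ((f ^ 2) ^ k) u = (k * a) • v + u := fun k => by
    induction k with
    | zero => simp
    | succ k ih =>
      rw [pow_succ', Module.End.mul_apply, ih, map_add, map_smul, hv2, ha]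
      push_cast
      module
  have ha0 : a = 0 := by
    have := hk n
    rw [← pow_mul, mul_comm, pow_mul, hf, one_pow, Module.End.one_apply, right_eq_add,
      smul_eq_zero_iff_left hv, mul_eq_zero] at this
    exact this.resolve_left (by exact_mod_cast hn)
  ext w
  obtain ⟨s, t, rfl⟩ := hmem w
  rw [map_add, map_smul, map_smul, hv2, ha, ha0]
  simp

/-- An automorphism of a real plane whose order is the square of a prime `p` has no nonzero vector of
period `p`. -/
theorem pow_apply_ne (hV : Module.finrank ℝ V = 2) {f : Module.End ℝ V} {p : ℕ} (hp : p.Prime)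
    (hf : orderOf f = p ^ 2) {v : V} (hv : v ≠ 0) : (f ^ p) v ≠ v := by
  intro hfv
  -- If `v` and `f v` form a basis, then `f ^ p` fixes both and is the identity. Otherwise `v` is an
  -- eigenvector and `f ^ 2 = 1`. Both contradict order `p ^ 2`, also for `p = 2`.
  by_cases hli : LinearIndependent ℝ ![v, f v]
  · have : FiniteDimensional ℝ V := Module.finite_of_finrank_pos (by omega)
    have hspan : Submodule.span ℝ {v, f v} = ⊤ := by
      have := hli.span_eq_top_of_card_eq_finrank' (by simp [hV])
      simpa [Set.pair_comm v] using this
    have h1 : f ^ p = 1 := by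
      ext w
      obtain ⟨a, b, rfl⟩ := Submodule.mem_span_pair.1 (hspan ▸ Submodule.mem_top : w ∈ _)
      have : (f ^ p) (f v) = f v := by
        rw [← Module.End.mul_apply, ← pow_succ, pow_succ', Module.End.mul_apply, hfv]
      rw [map_add, map_smul, map_smul, this, hfv]
      rfl
    have := Nat.le_of_dvd hp.pos (hf ▸ orderOf_dvd_of_pow_eq_one h1)
    nlinarith [hp.two_le]
  · have hc : ∃ c : ℝ, f v = c • v := by
      by_contra hne
      push Not at hne
      exact hli ((LinearIndependent.pair_iff' hv).2 fun a ha => hne a ha.symm)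
    obtain ⟨c, hc⟩ := hc
    have h1 := sq_eq_one_of_eigenvector hV (pow_ne_zero 2 hp.ne_zero) (hf ▸ pow_orderOf_eq_one f)
      hv hc
    have := Nat.le_of_dvd two_pos (hf ▸ orderOf_dvd_of_pow_eq_one h1)
    nlinarith [hp.two_le]

variable {Γ : Type u} [CommGroup Γ]

/-- An element of a commutative group fixing a nonzero vector of an irreducible representation acts
trivially. -/
theorem apply_eq_self_iff {ρ : Representation ℝ Γ V} (hρ : ρ.IsIrreducible) {v : V} (hv : v ≠ 0)
    (a : Γ) : ρ a v = v ↔ ρ a = 1 := by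
  refine ⟨fun h => ?_, fun h => by rw [h, Module.End.one_apply]⟩
  -- The fixed space of one element is invariant because the group is commutative; irreducibility
  -- leaves only zero or everything.
  let σ : Subrepresentation ρ := ⟨LinearMap.eqLocus (ρ a) 1, fun g w hw => by
    have hw : ρ a w = w := hw
    change ρ a (ρ g w) = ρ g w
    rw [← Module.End.mul_apply, ← map_mul, mul_comm, map_mul, Module.End.mul_apply, hw]⟩
  rcases hρ.eq_bot_or_eq_top σ with hσ | hσ
  · have h1 : v ∈ σ := h
    rw [hσ] at h1
    exact (hv h1).elim
  · ext w
    have h1 : w ∈ σ := by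
      rw [hσ]
      trivial
    exact h1

theorem nontrivial_of_isIrreducible {ρ : Representation ℝ Γ V} (hρ : ρ.IsIrreducible) :
    Nontrivial V := by
  by_contra hV
  rw [not_nontrivial_iff_subsingleton] at hV
  obtain ⟨σ, τ, hne⟩ := hρ.exists_pair_ne
  refine hne (SetLike.ext fun w => ?_)
  rw [Subsingleton.elim w 0]
  exact iff_of_true σ.toSubmodule.zero_mem τ.toSubmodule.zero_mem

end LinearAlgebra

/-! ### Stabilizers in arity supports -/

section AritySupport

variable {G : Type u} [CommGroup G] [Finite G] {A : Subgroup G} {V : Type v} [AddCommGroup V]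
  [Module ℝ V]

/-- Every nonzero vector has stabilizer `N`. -/
def FixesExactly (ρ : Representation ℝ A V) (N : Subgroup G) : Prop :=
  ∀ v ≠ 0, ∀ a : A, ρ a v = v ↔ (a : G) ∈ N

omit [Finite G] in
theorem stab_of_equivariant (ρ : Representation ℝ A V) {H : Subgroup G} (hH : H ≤ A) {S : FinAct H}
    {e : S.carrier → V} (he : Function.Injective e)
    (hes : ∀ (h : H) (s : S.carrier), e (h • s) = ρ (Subgroup.inclusion hH h) (e s))
    (s : S.carrier) {g : G} (hg : g ∈ H) : g ∈ stab S s ↔ ρ ⟨g, hH hg⟩ (e s) = e s := by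
  have h1 := hes ⟨g, hg⟩ s
  rw [show Subgroup.inclusion hH ⟨g, hg⟩ = ⟨g, hH hg⟩ from rfl] at h1
  rw [mem_stab, ← h1, he.eq_iff]
  exact ⟨fun ⟨_, h⟩ => h, fun h => ⟨hg, h⟩⟩

/-- Points embedded at nonzero vectors have stabilizer `N ⊓ H`, and at most one point sits at the
origin. This bounds the pattern of the support from above. -/
theorem FixesExactly.stab_eq {ρ : Representation ℝ A V} {N : Subgroup G} (hρ : FixesExactly ρ N)
    {H : Subgroup G} {S : FinAct H} (hS : (WeakIndexingSystem.aritySupport ρ).mem H S) :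
    (∀ s, stab S s = N ⊓ H ∨ stab S s = H) ∧
      ∀ s t, s ≠ t → stab S t = H → stab S s = N ⊓ H := by
  obtain ⟨hH, e, he, hes⟩ := hS
  have h1 : ∀ s, e s ≠ 0 → stab S s = N ⊓ H := fun s hs => by
    ext g
    rw [Subgroup.mem_inf]
    constructor
    · intro hg
      have hgH := stab_le S s hg
      exact ⟨(hρ _ hs _).1 ((stab_of_equivariant ρ hH he hes s hgH).1 hg), hgH⟩
    · rintro ⟨hgN, hgH⟩
      exact (stab_of_equivariant ρ hH he hes s hgH).2 ((hρ _ hs _).2 hgN)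
  have h2 : ∀ s, e s = 0 → stab S s = H := fun s hs => by
    refine le_antisymm (stab_le S s) fun g hg => ?_
    rw [stab_of_equivariant ρ hH he hes s hg, hs, map_zero]
  refine ⟨fun s => ?_, fun s t hst ht => ?_⟩
  · by_cases hs : e s = 0
    · exact Or.inr (h2 s hs)
    · exact Or.inl (h1 s hs)
  · by_cases hs : e s = 0
    -- If `s` is at the origin, then the other fixed point `t` is a nonzero vector, which forces `N
    -- ⊓ H = H`.
    · have htN := h1 t fun h => hst (he (hs.trans h.symm))
      rw [h2 s hs, ← htN, ht]
    · exact h1 s hs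

/-- The orbit of a nonzero vector together with the origin is a copy of `[A/N] ⊔ *` inside `V`. -/
theorem FixesExactly.pointedTransfer {ρ : Representation ℝ A V} [Nontrivial V] {N : Subgroup G}
    (hρ : FixesExactly ρ N) (hN : N ≤ A) :
    (WeakIndexingSystem.aritySupport ρ).PointedTransfer N A := by
  obtain ⟨v, hv⟩ := exists_ne (0 : V)
  have key : ∀ a b : A, ρ a v = ρ b v ↔ (a : G)⁻¹ * b ∈ N := fun a b => by
    have hinj : Function.Injective (ρ a⁻¹) :=
      Function.LeftInverse.injective (g := ρ a) fun w => by
        rw [← Module.End.mul_apply, ← map_mul, mul_inv_cancel, map_one, Module.End.one_apply]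
    have := hρ v hv (a⁻¹ * b)
    rw [eq_comm, ← hinj.eq_iff, ← Module.End.mul_apply, ← Module.End.mul_apply, ← map_mul,
      ← map_mul, inv_mul_cancel, map_one, Module.End.one_apply]
    exact this
  let f : (orbit hN).carrier → V := Quotient.lift (fun a : A => ρ a v) fun a b hab =>
    (key a b).2 ((orbit.mk_eq_iff hN a b).1 (Quotient.sound hab))
  have hf : ∀ a, f (orbit.mk hN a) = ρ a v := fun _ => rfl
  refine ⟨hN, le_rfl, fun z : (orbit hN).carrier ⊕ PUnit => Sum.elim f (fun _ => 0) z, ?_, ?_⟩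
  · refine Function.Injective.sumElim (fun z z' h => ?_) (fun _ _ _ => rfl) fun z _ h => ?_
    · obtain ⟨a, rfl⟩ := orbit.exists_rep z
      obtain ⟨b, rfl⟩ := orbit.exists_rep z'
      exact (orbit.mk_eq_iff hN a b).2 ((key a b).1 h)
    · obtain ⟨a, rfl⟩ := orbit.exists_rep z
      rw [hf] at h
      have h' := congrArg (ρ a⁻¹) h
      rw [← Module.End.mul_apply, ← map_mul, inv_mul_cancel, map_one, Module.End.one_apply,
        map_zero] at h'
      exact hv h'
  · intro h z
    obtain ⟨z, rfl⟩ | ⟨z, rfl⟩ := FinAct.eq_inl_or_inr z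
    · obtain ⟨a, rfl⟩ := orbit.exists_rep z
      change ρ (h * a) v = ρ h (ρ a v)
      rw [map_mul, Module.End.mul_apply]
    · exact (map_zero (ρ h)).symm

theorem zero_le_aritySupport (ρ : Representation ℝ A V) :
    WeakIndexingSystem.zero A ≤ WeakIndexingSystem.aritySupport ρ := fun _ _ ⟨hH, hS⟩ =>
  ⟨hH, fun _ => 0, fun s t _ => hS.elim s t, fun _ _ => (map_zero _).symm⟩

/-- An injective intertwining map induces an inclusion of arity supports. -/
theorem aritySupport_le_of_injective {W : Type w} [AddCommGroup W] [Module ℝ W]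
    {ρ : Representation ℝ A V} {σ : Representation ℝ A W} (f : V → W) (hf : Function.Injective f)
    (h : ∀ a v, f (ρ a v) = σ a (f v)) :
    WeakIndexingSystem.aritySupport ρ ≤ WeakIndexingSystem.aritySupport σ :=
  fun _ _ ⟨hH, e, he, hes⟩ => ⟨hH, f ∘ e, hf.comp he, fun a s => by
    rw [Function.comp_apply, hes, h, Function.comp_apply]⟩

end AritySupport

/-! ### Comparison of the labels with the patterns -/

section Comparison

open WeakIndexingSystem

variable {G : Type u} [CommGroup G] [Finite G]

theorem WeakIndexingSystem.Transfer.mono {A : Subgroup G} {I J : WeakIndexingSystem A} (h : I ≤ J)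
    {K H : Subgroup G} (hK : I.Transfer K H) : J.Transfer K H :=
  ⟨hK.1, h _ _ hK.2⟩

theorem WeakIndexingSystem.PointedTransfer.mono {A : Subgroup G} {I J : WeakIndexingSystem A}
    (h : I ≤ J) {K H : Subgroup G} (hK : I.PointedTransfer K H) : J.PointedTransfer K H :=
  ⟨hK.1, h _ _ hK.2⟩

/-- The transfer system of a pattern. -/
def IsPattern.transferSystem {r q : Subgroup G → Subgroup G → Prop} (h : IsPattern r q) :
    TransferSystem G where
  rel := r
  le := h.le
  refl := h.refl
  trans := h.trans
  conj g hr := by rwa [map_conj_eq, map_conj_eq]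
  restrict := h.restrict

theorem fold_transfer {B H : Subgroup G} (hH : H ≤ B) : (fold B).PointedTransfer H H := by
  refine PointedTransfer.mono (I := extend ⊤ le_top (infty B)) le_sup_right ⟨le_rfl, hH, ?_⟩
  intro h s
  refine stab_eq_iff.1 ?_ h
  obtain ⟨s, rfl⟩ | ⟨s, rfl⟩ := FinAct.eq_inl_or_inr s
  · rw [stab_inl, stab_orbit]
  · rw [stab_inr, stab_point]

theorem bar_transfer {R : TransferSystem G} {K H : Subgroup G} (h : R.rel K H) :
    (bar R).Transfer K H := by
  refine Transfer.mono (I := closure fun H S => ∃ (K : Subgroup G) (h : K ≤ H), R.rel K H ∧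
    S.Iso (orbit h)) le_sup_right ⟨R.le h, le_top, fun I hI => ?_⟩
  exact hI H _ ⟨K, R.le h, h, Equiv.refl _, fun _ _ => rfl⟩

section Bounds

variable (e : Subgroup G ≃o Fin 3) {a : Vertex}

theorem extend_infty_le {B : Subgroup G} (h : ∀ H ≤ B, a.PointedRel (e H) (e H)) :
    extend ⊤ le_top (infty B) ≤ a.system e := fun H S ⟨hH, hS⟩ => by
  have hst : ∀ s, stab S s = H := fun s => stab_eq_iff.2 fun g => hS g s
  refine ⟨fun s => ?_, fun s t _ _ => ?_⟩
  · rw [hst]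
    exact Or.inl rfl
  · rw [hst]
    exact h H hH

theorem fold_le {B : Subgroup G} (h : ∀ H ≤ B, a.PointedRel (e H) (e H)) :
    fold B ≤ a.system e :=
  sup_le (a.zero_le_system e) (extend_infty_le e h)

theorem bar_le {R : TransferSystem G} (h : ∀ K H, R.rel K H → a.Rel (e K) (e H)) :
    bar R ≤ a.system e := by
  refine sup_le (a.zero_le_system e) (sInf_le ?_)
  rintro H S ⟨K, hK, hR, hS⟩
  exact (a.system e).iso_mem hS.symm ((orbit_mem_ofPattern _ hK).2 (h K H hR))

theorem extend_aritySupport_le {A N : Subgroup G} {V : Type v} [AddCommGroup V] [Module ℝ V]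
    {ρ : Representation ℝ A V} (hρ : FixesExactly ρ N)
    (h : ∀ H ≤ A, a.PointedRel (e (N ⊓ H)) (e H)) :
    extend ⊤ le_top (aritySupport ρ) ≤ a.system e := fun H S hS => by
  have hH := hS.1
  obtain ⟨h1, h2⟩ := hρ.stab_eq hS
  refine ⟨fun s => ?_, fun s t hst ht => ?_⟩
  · rcases h1 s with hs | hs
    · rw [hs]
      exact a.isPattern.rel (h H hH)
    · rw [hs]
      exact Or.inl rfl
  · rw [h2 s t hst ht]
    exact h H hH

/-- By the classification `I` is the system of some vertex `b`, and the upper bound gives `b ≤ a`.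
What remains is a finite question: which vertices below `a` contain the transfers known to lie in
`I`. -/
theorem system_eq {I : WeakIndexingSystem (⊤ : Subgroup G)} (h0 : WeakIndexingSystem.zero ⊤ ≤ I)
    (hle : I ≤ a.system e)
    (h : ∀ b, b ≤ a → (∀ K H, I.Transfer K H → b.Rel (e K) (e H)) →
      (∀ K H, I.PointedTransfer K H → b.PointedRel (e K) (e H)) → b = a) : a.system e = I := by
  obtain ⟨b, rfl⟩ := Vertex.exists_system_eq e h0
  rw [h b ((Vertex.system_le_system e).1 hle)
    (fun K H hK => (orbit_mem_ofPattern _ hK.1).1 hK.2)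
    (fun K H hK => (orbit_sum_point_mem_ofPattern _ hK.1).1 hK.2)]

/-- Indexing systems are the case in which `r` implies `q`, so the condition involving fixed points
is vacuous. -/
theorem ofTransfer_eq {R : TransferSystem G} (hR : ∀ K H, R.rel K H ↔ a.Rel (e K) (e H))
    (h : ∀ i j, a.Rel i j → a.PointedRel i j) : a.system e = ofTransfer R := by
  refine le_antisymm (fun H S hS s => (hR _ _).2 (hS.1 s)) fun H S hS => ?_
  have h1 : ∀ s, a.Rel (e (stab S s)) (e H) := fun s => (hR _ _).1 (hS s)
  exact ⟨h1, fun s _ _ _ => h _ _ (h1 s)⟩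

end Bounds

section Transfers

variable (e : Subgroup G ≃o Fin 3) {C : Subgroup G} (hC : e C = 1)

omit [Finite G] in
include hC in
-- A generated transfer system is bounded above by testing it against the transfer system of the
-- vertex; conversely each listed arrow is produced from the generator.
theorem transfer_rel_iff (a : Vertex) (K H : Subgroup G) :
    (a.transfer C).rel K H ↔ a.Rel (e K) (e H) := by
  have h0 : e ⊥ = 0 := e.map_bot
  have h2 : e ⊤ = 2 := e.map_top
  have hgen : ∀ (b : Vertex) {J L : Subgroup G} (h : J ≤ L), b.Rel (e J) (e L) →
      (TransferSystem.generate h).rel K H → b.Rel (e K) (e H) := fun b J L h hb hr =>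
    hr (b.isPattern.comap e).transferSystem hb
  have hinj : ∀ {J L : Subgroup G}, e J = e L → J = L := fun h => e.injective h
  have hR1 : (TransferSystem.generate (bot_le : ⊥ ≤ C)).rel K H ↔
      Vertex.Rel .bar1 (e K) (e H) := by
    refine ⟨hgen _ _ (by rw [h0, hC]; decide), ?_⟩
    rintro (h | h)
    · exact hinj h ▸ TransferSystem.refl _ _
    · have h : e K = 0 ∧ e H = 1 := by simpa [Vertex.transfers] using h
      rw [hinj (h.1.trans h0.symm), hinj (h.2.trans hC.symm)]
      exact fun R hR => hR
  have hR2 : (TransferSystem.generate (le_top : C ≤ ⊤)).rel K H ↔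
      Vertex.Rel .bar2 (e K) (e H) := by
    refine ⟨hgen _ _ (by rw [h2, hC]; decide), ?_⟩
    rintro (h | h)
    · exact hinj h ▸ TransferSystem.refl _ _
    · have h : e K = 1 ∧ e H = 2 := by simpa [Vertex.transfers] using h
      rw [hinj (h.1.trans hC.symm), hinj (h.2.trans h2.symm)]
      exact fun R hR => hR
  have hR3 : (TransferSystem.generate (bot_le : (⊥ : Subgroup G) ≤ ⊤)).rel K H ↔
      Vertex.Rel .bar3 (e K) (e H) := by
    refine ⟨hgen _ _ (by rw [h0, h2]; decide), ?_⟩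
    rintro (h | h)
    · exact hinj h ▸ TransferSystem.refl _ _
    · have h : e K = 0 := by
        have : e K = 0 ∧ e H = 1 ∨ e K = 0 ∧ e H = 2 := by simpa [Vertex.transfers] using h
        exact this.elim And.left And.left
      rw [hinj (h.trans h0.symm)]
      intro R hR
      -- Restricting `e → G` to `H` gives `e → H`; this is how `e → C_{p²}` generates `e → C_p`.
      simpa using R.restrict hR (le_top : H ≤ ⊤)
  have hR0 : (TransferSystem.trivial G).rel K H ↔ Vertex.Rel .zero (e K) (e H) := by
    simp [TransferSystem.trivial, Vertex.Rel, Vertex.transfers]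
  have hR4 : (TransferSystem.complete G).rel K H ↔ Vertex.Rel .bar4 (e K) (e H) := by
    have : ∀ i j, Vertex.Rel .bar4 i j ↔ i ≤ j := by decide
    rw [this, e.le_iff_le]
    rfl
  cases a
  all_goals first | exact hR0 | exact hR1 | exact hR2 | exact hR3 | exact hR4

omit [Finite G] in
include hC in
theorem mem_foldFamily_iff (a : Vertex) (H : Subgroup G) :
    H ∈ a.foldFamily C ↔ a.PointedRel (e H) (e H) := by
  have hE : H ≤ ⊥ ↔ e H ≤ 0 := by
    rw [← e.le_iff_le, e.map_bot]
    rfl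
  have hC' : H ≤ C ↔ e H ≤ 1 := by rw [← e.le_iff_le, hC]
  have h1 : ∀ b ∈ [Vertex.foldE, .bar1, .bar3, .ext1, .ext3, .disk3], ∀ i,
      b.PointedRel i i ↔ i ≤ 0 := by decide
  have h2 : ∀ b ∈ [Vertex.foldC, .foldCBar1, .bar2, .foldCBar3, .bar4, .foldCDisk3, .barDisk,
      .disk2, .diskSum], ∀ i, b.PointedRel i i ↔ i ≤ 1 := by decide
  have h3 : ∀ b ∈ [Vertex.foldG, .full1, .full2, .full3, .full4], ∀ i, b.PointedRel i i := by
    decide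
  cases a
  case zero => exact iff_of_false id (by simp [Vertex.PointedRel, Vertex.pointedTransfers])
  all_goals first
    | exact hE.trans (h1 _ (by decide) _).symm
    | exact hC'.trans (h2 _ (by decide) _).symm
    | exact iff_of_true trivial (h3 _ (by decide) _)

end Transfers

end Comparison

/-! ### Identification of the 21 labels -/

section Labels

open WeakIndexingSystem

variable {G : Type u} [CommGroup G] [Finite G] {C : Subgroup G}
  {V : Type v} [AddCommGroup V] [Module ℝ V] {W : Type w} [AddCommGroup W] [Module ℝ W]
  {U : Type*} [AddCommGroup U] [Module ℝ U]

theorem zero_le_label (ρ₂ : Representation ℝ G V) (ρ₁ : Representation ℝ G W)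
    (ρ₀ : Representation ℝ C U) (a : Vertex) :
    WeakIndexingSystem.zero ⊤ ≤ a.label C ρ₂ ρ₁ ρ₀ := by
  have hR : ∀ R : TransferSystem G, WeakIndexingSystem.zero ⊤ ≤ ofTransfer R :=
    fun R H S ⟨_, hS⟩ s => by
      rw [stab_eq_iff.2 fun g => hS.elim (g • s) s]
      exact R.refl H
  cases a
  case zero => exact le_rfl
  case foldG => exact fun H S ⟨hH, hS⟩ => ⟨hH, fun g s => hS.elim _ _⟩
  all_goals first
    | exact le_sup_left
    | exact le_sup_left.trans le_sup_left
    | exact zero_le_aritySupport _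
    | exact hR _

/-- The systems of the classification are the given labels. -/
theorem system_eq_label (e : Subgroup G ≃o Fin 3) (hC : e C = 1) {ρ₂ : Representation ℝ G V}
    {ρ₁ : Representation ℝ G W} {ρ₀ : Representation ℝ C U} [Nontrivial V] [Nontrivial W]
    [Nontrivial U] (h₂ : FixesExactly (ρ₂.comp (⊤ : Subgroup G).subtype) ⊥)
    (h₁ : FixesExactly (ρ₁.comp (⊤ : Subgroup G).subtype) C) (h₀ : FixesExactly ρ₀ ⊥) (a : Vertex) :
    a.system e = a.label C ρ₂ ρ₁ ρ₀ := by
  have e0 : e ⊥ = 0 := e.map_bot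
  have e2 : e ⊤ = 2 := e.map_top
  have hl := zero_le_label ρ₂ ρ₁ ρ₀ a
  have ht := transfer_rel_iff e hC a
  have hbot : ∀ H ≤ (⊥ : Subgroup G), e H = 0 := fun H hH => by rw [le_bot_iff.1 hH, e0]
  have hCle : ∀ H ≤ C, e H ≤ 1 := fun H hH => hC ▸ e.monotone hH
  -- upper bounds
  have hbar : ∀ a : Vertex, bar (a.transfer C) ≤ a.system e := fun a =>
    bar_le e fun K H => (transfer_rel_iff e hC a K H).1
  have hfold0 : ∀ a : Vertex, a.PointedRel 0 0 → fold ⊥ ≤ a.system e := fun a ha =>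
    fold_le e fun H hH => hbot H hH ▸ ha
  have hfoldC : ∀ a : Vertex, (∀ i ≤ 1, a.PointedRel i i) → fold C ≤ a.system e := fun a ha =>
    fold_le e fun H hH => ha _ (hCle H hH)
  have hext : ∀ a : Vertex, (∀ i ≤ 1, a.PointedRel 0 i) →
      extend ⊤ le_top (aritySupport ρ₀) ≤ a.system e := fun a ha =>
    extend_aritySupport_le e h₀ fun H hH => by
      rw [bot_inf_eq, e0]
      exact ha _ (hCle H hH)
  have hd2 : ∀ a : Vertex, (∀ i, a.PointedRel 0 i) → disks ρ₂ ≤ a.system e := fun a ha =>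
    extend_aritySupport_le e h₂ fun H _ => by
      rw [bot_inf_eq, e0]
      exact ha _
  have hd1 : disks ρ₁ ≤ Vertex.disk2.system e :=
    extend_aritySupport_le e h₁ fun H _ => by
      rw [e.map_inf, hC]
      exact (by decide : ∀ i, Vertex.disk2.PointedRel (1 ⊓ i) i) _
  have hsum : disks (ρ₂.prod ρ₁) ≤ Vertex.diskSum.system e := by
    rintro H S ⟨hH, f, hf, hfs⟩
    -- The sum does not have uniform stabilizers, so it is treated directly. The pattern of
    -- `diskSum` omits only `q` at the whole group, so it suffices that the origin is the only
    -- vector fixed by `G`.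
    have hr : ∀ i j, i ≤ j → Vertex.diskSum.Rel i j := by decide
    have hq : ∀ i j, i ≤ j → ¬ (i = 2 ∧ j = 2) → Vertex.diskSum.PointedRel i j := by decide
    refine ⟨fun s => hr _ _ (e.monotone (stab_le S s)), fun s t hst ht =>
      hq _ _ (e.monotone (stab_le S s)) ?_⟩
    rintro ⟨hs2, hH2⟩
    obtain rfl : H = ⊤ := e.injective (hH2.trans e2.symm)
    have hs : stab S s = ⊤ := e.injective (hs2.trans e2.symm)
    have hfix : ∀ x, stab S x = ⊤ → f x = 0 := fun x hx => by
      have h1 : ∀ g : G, ρ₂.prod ρ₁ g (f x) = f x := fun g =>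
        (stab_of_equivariant ((ρ₂.prod ρ₁).comp (⊤ : Subgroup G).subtype) hH hf hfs x
          (Subgroup.mem_top g)).1 (hx.symm ▸ Subgroup.mem_top g)
      refine Prod.ext ?_ ?_
      · by_contra hne
        have : (⊤ : Subgroup G) ≤ ⊥ := fun g _ =>
          (h₂ _ hne ⟨g, trivial⟩).1 (congrArg Prod.fst (h1 g))
        have := e.monotone this
        rw [e0, e2] at this
        exact absurd this (by decide)
      · by_contra hne
        have : (⊤ : Subgroup G) ≤ C := fun g _ =>
          (h₁ _ hne ⟨g, trivial⟩).1 (congrArg Prod.snd (h1 g))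
        have := e.monotone this
        rw [hC, e2] at this
        exact absurd this (by decide)
    exact hst (hf ((hfix s hs).trans (hfix t ht).symm))
  -- lower bounds
  have t1 : (bar (Vertex.bar1.transfer C)).Transfer ⊥ C :=
    bar_transfer ((transfer_rel_iff e hC _ _ _).2 (by rw [e0, hC]; decide))
  have t2 : (bar (Vertex.bar2.transfer C)).Transfer C ⊤ :=
    bar_transfer ((transfer_rel_iff e hC _ _ _).2 (by rw [e2, hC]; decide))
  have t3 : (bar (Vertex.bar3.transfer C)).Transfer ⊥ ⊤ :=
    bar_transfer ((transfer_rel_iff e hC _ _ _).2 (by rw [e0, e2]; decide))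
  have t4 : (bar (Vertex.bar4.transfer C)).Transfer C ⊤ :=
    bar_transfer ((transfer_rel_iff e hC _ _ _).2 (by rw [e2, hC]; decide))
  have t4' : (bar (Vertex.bar4.transfer C)).Transfer ⊥ C :=
    bar_transfer ((transfer_rel_iff e hC _ _ _).2 (by rw [e0, hC]; decide))
  have tf0 : (fold (⊥ : Subgroup G)).PointedTransfer ⊥ ⊥ := fold_transfer le_rfl
  have tfC : (fold C).PointedTransfer C C := fold_transfer le_rfl
  have tfG : (infty (⊤ : Subgroup G)).PointedTransfer ⊤ ⊤ :=
    PointedTransfer.mono (I := fold ⊤) (J := infty ⊤) (sup_le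
      (fun _ _ hS => ⟨hS.1, fun _ _ => hS.2.elim _ _⟩) (fun _ _ hS => hS)) (fold_transfer le_rfl)
  have te : (extend ⊤ le_top (aritySupport ρ₀)).PointedTransfer ⊥ C := h₀.pointedTransfer bot_le
  have td2 : (disks ρ₂).PointedTransfer ⊥ ⊤ := h₂.pointedTransfer bot_le
  have td1 : (disks ρ₁).PointedTransfer C ⊤ := h₁.pointedTransfer le_top
  have ts2 : (disks (ρ₂.prod ρ₁)).PointedTransfer ⊥ ⊤ :=
    td2.mono (aritySupport_le_of_injective (fun v => (v, 0))
      (fun _ _ h => congrArg Prod.fst h) fun g _ => Prod.ext rfl (map_zero (ρ₁ g)).symm)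
  have ts1 : (disks (ρ₂.prod ρ₁)).PointedTransfer C ⊤ :=
    td1.mono (aritySupport_le_of_injective (fun v => (0, v))
      (fun _ _ h => congrArg Prod.snd h) fun g _ => Prod.ext (map_zero (ρ₂ g)).symm rfl)
  -- In each case before the full indexing systems, `decide` confirms that no strictly smaller
  -- vertex contains the chosen witnesses.
  cases a
  case zero =>
    exact system_eq e hl (zero_le_ofPattern _) fun b hb _ _ =>
        (by decide : ∀ b ≤ Vertex.zero, b = .zero) b hb
  case foldE =>
    exact system_eq e hl (hfold0 _ (by decide)) fun b hb _ hq =>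
        (by decide : ∀ b ≤ Vertex.foldE, b.PointedRel 0 0 → b = .foldE) b hb
          (by simpa only [e0] using hq _ _ tf0)
  case bar1 =>
    exact system_eq e hl (hbar .bar1) fun b hb hr _ =>
        (by decide : ∀ b ≤ Vertex.bar1, b.Rel 0 1 → b = .bar1) b hb
          (by simpa only [e0, hC] using hr _ _ t1)
  case bar3 =>
    exact system_eq e hl (hbar .bar3) fun b hb hr _ =>
        (by decide : ∀ b ≤ Vertex.bar3, b.Rel 0 2 → b = .bar3) b hb
          (by simpa only [e0, e2] using hr _ _ t3)
  case ext1 =>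
    exact system_eq e hl
      (sup_le (zero_le_ofPattern _) (hext _ (by decide))) fun b hb _ hq =>
        (by decide : ∀ b ≤ Vertex.ext1, b.PointedRel 0 1 → b = .ext1) b hb
          (by simpa only [e0, hC] using hq _ _ (te.mono le_sup_right))
  case ext3 =>
    exact system_eq e hl (sup_le (hbar .ext3) (hext _ (by decide))) fun b hb hr hq =>
        (by decide : ∀ b ≤ Vertex.ext3, b.Rel 0 2 → b.PointedRel 0 1 → b = .ext3) b hb
          (by simpa only [e0, e2] using hr _ _ (t3.mono le_sup_left))
          (by simpa only [e0, hC] using hq _ _ (te.mono le_sup_right))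
  case disk3 =>
    exact system_eq e hl (hd2 _ (by decide)) fun b hb _ hq =>
        (by decide : ∀ b ≤ Vertex.disk3, b.PointedRel 0 2 → b = .disk3) b hb
          (by simpa only [e0, e2] using hq _ _ td2)
  case foldC =>
    exact system_eq e hl (hfoldC _ (by decide)) fun b hb _ hq =>
        (by decide : ∀ b ≤ Vertex.foldC, b.PointedRel 1 1 → b = .foldC) b hb
          (by simpa only [hC] using hq _ _ tfC)
  case foldCBar1 =>
    exact system_eq e hl
      (sup_le (hfoldC _ (by decide)) (hbar .foldCBar1)) fun b hb hr hq =>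
        (by decide : ∀ b ≤ Vertex.foldCBar1, b.Rel 0 1 → b.PointedRel 1 1 → b = .foldCBar1) b hb
          (by simpa only [e0, hC] using hr _ _ (t1.mono le_sup_right))
          (by simpa only [hC] using hq _ _ (tfC.mono le_sup_left))
  case bar2 =>
    exact system_eq e hl (hbar .bar2) fun b hb hr _ =>
        (by decide : ∀ b ≤ Vertex.bar2, b.Rel 1 2 → b = .bar2) b hb
          (by simpa only [e2, hC] using hr _ _ t2)
  case foldCBar3 =>
    exact system_eq e hl
      (sup_le (hfoldC _ (by decide)) (hbar .foldCBar3)) fun b hb hr hq =>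
        (by decide : ∀ b ≤ Vertex.foldCBar3, b.Rel 0 2 → b.PointedRel 1 1 → b = .foldCBar3) b hb
          (by simpa only [e0, e2] using hr _ _ (t3.mono le_sup_right))
          (by simpa only [hC] using hq _ _ (tfC.mono le_sup_left))
  case bar4 =>
    exact system_eq e hl (hbar .bar4) fun b hb hr _ =>
        (by decide : ∀ b ≤ Vertex.bar4, b.Rel 0 1 → b.Rel 1 2 → b = .bar4) b hb
          (by simpa only [e0, hC] using hr _ _ t4') (by simpa only [e2, hC] using hr _ _ t4)
  case foldCDisk3 =>
    exact system_eq e hl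
      (sup_le (hfoldC _ (by decide)) (hd2 _ (by decide))) fun b hb _ hq =>
        (by decide : ∀ b ≤ Vertex.foldCDisk3, b.PointedRel 1 1 → b.PointedRel 0 2 → b = .foldCDisk3)
          b hb (by simpa only [hC] using hq _ _ (tfC.mono le_sup_left))
          (by simpa only [e0, e2] using hq _ _ (td2.mono le_sup_right))
  case barDisk =>
    exact system_eq e hl
      (sup_le (hbar .barDisk) (hd2 _ (by decide))) fun b hb hr hq =>
        (by decide : ∀ b ≤ Vertex.barDisk, b.Rel 1 2 → b.PointedRel 0 2 → b = .barDisk) b hb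
          (by simpa only [e2, hC] using hr _ _ (t4.mono le_sup_left))
          (by simpa only [e0, e2] using hq _ _ (td2.mono le_sup_right))
  case disk2 =>
    exact system_eq e hl hd1 fun b hb _ hq =>
        (by decide : ∀ b ≤ Vertex.disk2, b.PointedRel 1 2 → b = .disk2) b hb
          (by simpa only [e2, hC] using hq _ _ td1)
  case diskSum =>
    exact system_eq e hl hsum fun b hb _ hq =>
        (by decide : ∀ b ≤ Vertex.diskSum, b.PointedRel 0 2 → b.PointedRel 1 2 → b = .diskSum) b hb
          (by simpa only [e0, e2] using hq _ _ ts2) (by simpa only [e2, hC] using hq _ _ ts1)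
  case foldG =>
    exact system_eq e hl
        (extend_infty_le e fun H _ => (by decide : ∀ i, Vertex.foldG.PointedRel i i) _) fun b hb _ hq =>
        (by decide : ∀ b ≤ Vertex.foldG, b.PointedRel 2 2 → b = .foldG) b hb
          (by simpa only [e2] using hq _ _ tfG)
  all_goals exact ofTransfer_eq e ht (by decide)

end Labels

/-! ### Subgroups and representations of the cyclic group of order `p²` -/

section CyclicGroup

variable {G : Type u} [CommGroup G] [Finite G] {p : ℕ} {C : Subgroup G}

/-- In a cyclic group of order `p²`, the only subgroups are the trivial one, the one of order `p`, and
the whole group. -/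
theorem eq_bot_or_eq_or_eq_top (hp : p.Prime) (hG : Nat.card G = p ^ 2) [IsCyclic G]
    (hC : Nat.card C = p) (K : Subgroup G) : K = ⊥ ∨ K = C ∨ K = ⊤ := by
  obtain ⟨k, hk, hK⟩ := (Nat.dvd_prime_pow hp).1 (hG ▸ K.card_subgroup_dvd_card)
  interval_cases k
  · exact Or.inl (K.card_eq_one.1 (by simpa using hK))
  · rw [pow_one] at hK
    refine Or.inr (Or.inl ?_)
    classical
    have := Fintype.ofFinite G
    -- A subgroup of order `p` lies in the solution set of `a ^ p = 1`, which has at most `p`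
    -- elements in a cyclic group, so it is that solution set.
    have hle : ∀ L : Subgroup G, Nat.card L = p →
        (L : Set G).toFinset = Finset.univ.filter fun a : G => a ^ p = 1 := fun L hL => by
      refine Finset.eq_of_subset_of_card_le (fun a ha => ?_) ?_
      · have ha : a ∈ L := by simpa using ha
        rw [Finset.mem_filter]
        refine ⟨Finset.mem_univ a, ?_⟩
        have := pow_card_eq_one' (x := (⟨a, ha⟩ : L))
        rw [hL] at this
        exact congrArg Subtype.val this
      · refine (IsCyclic.card_pow_eq_one_le hp.pos).trans ?_
        rw [Set.toFinset_card, ← Nat.card_eq_fintype_card]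
        exact hL.ge
    have h := (hle K hK).trans (hle C hC).symm
    exact SetLike.coe_injective (by simpa using h)
  · exact Or.inr (Or.inr (K.card_eq_iff_eq_top.1 (hK.trans hG.symm)))

/-- The numbering of the subgroups of a cyclic group of order `p²`. -/
theorem exists_subgroup_orderIso (hp : p.Prime) (hG : Nat.card G = p ^ 2) [IsCyclic G]
    (hC : Nat.card C = p) : ∃ e : Subgroup G ≃o Fin 3, e C = 1 := by
  have hbot : ⊥ < C := bot_lt_iff_ne_bot.2 fun h => hp.ne_one (by rw [← hC, h, Subgroup.card_bot])
  have htop : C < ⊤ := lt_top_iff_ne_top.2 fun h => by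
    rw [h, Subgroup.card_top, hG] at hC
    nlinarith [hp.two_le]
  have hmono : StrictMono (![⊥, C, ⊤] : Fin 3 → Subgroup G) := by
    rw [Fin.strictMono_iff_lt_succ]
    intro i
    fin_cases i
    · exact hbot
    · exact htop
  have hsurj : Function.Surjective (![⊥, C, ⊤] : Fin 3 → Subgroup G) := fun K => by
    obtain h | h | h := eq_bot_or_eq_or_eq_top hp hG hC K
    · exact ⟨0, h.symm⟩
    · exact ⟨1, h.symm⟩
    · exact ⟨2, h.symm⟩
  refine ⟨(hmono.orderIsoOfSurjective _ hsurj).symm, ?_⟩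
  rw [OrderIso.symm_apply_eq]
  rfl

/-- The element `x ^ p` generates `C`, the least nontrivial subgroup; nontriviality of a stabilizer
can therefore be tested on it alone. -/
theorem pow_mem_of_ne_one (hp : p.Prime) (hG : Nat.card G = p ^ 2) [IsCyclic G]
    (hC : Nat.card C = p) {x : G} (hx : orderOf x = p ^ 2) {K : Subgroup G} (hK : K ≠ ⊥) :
    x ^ p ∈ K := by
  have hCx : Subgroup.zpowers (x ^ p) = C := by
    have hcard : Nat.card (Subgroup.zpowers (x ^ p)) = p := by
      rw [Nat.card_zpowers, orderOf_pow' x hp.ne_zero, hx, 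
        Nat.gcd_eq_right (dvd_pow_self p two_ne_zero), sq, Nat.mul_div_cancel _ hp.pos]
    obtain h | h | h := eq_bot_or_eq_or_eq_top hp hG hC (Subgroup.zpowers (x ^ p))
    · rw [h, Subgroup.card_bot] at hcard
      exact (hp.ne_one hcard.symm).elim
    · exact h
    · rw [h, Subgroup.card_top, hG] at hcard
      nlinarith [hp.two_le]
  obtain h | h | h := eq_bot_or_eq_or_eq_top hp hG hC K
  · exact (hK h).elim
  · rw [h, ← hCx]
    exact Subgroup.mem_zpowers _
  · rw [h]
    trivial

variable {V : Type v} [AddCommGroup V] [Module ℝ V]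

/-- A nontrivial stabilizer of a nonzero vector would contain `x ^ p`, which `pow_apply_ne`
excludes. -/
theorem fixesExactly_of_finrank_eq_two (hp : p.Prime) (hG : Nat.card G = p ^ 2) [IsCyclic G]
    (hC : Nat.card C = p) {x : G} (hx : orderOf x = p ^ 2) {ρ : Representation ℝ G V}
    (hV : Module.finrank ℝ V = 2) (hρ : orderOf (ρ x) = p ^ 2) :
    FixesExactly (ρ.comp (⊤ : Subgroup G).subtype) ⊥ := by
  rintro v hv ⟨g, hg⟩
  change ρ g v = v ↔ g ∈ (⊥ : Subgroup G)
  rw [Subgroup.mem_bot]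
  refine ⟨fun h => ?_, fun h => by rw [h, map_one, Module.End.one_apply]⟩
  by_contra hne
  let F : Subgroup G :=
    { carrier := {a | ρ a v = v}
      one_mem' := by simp
      mul_mem' := fun {a b} (ha : ρ a v = v) (hb : ρ b v = v) =>
        show ρ (a * b) v = v by rw [map_mul, Module.End.mul_apply, hb, ha]
      inv_mem' := fun {a} (ha : ρ a v = v) => show ρ a⁻¹ v = v by
        conv_lhs => rw [← ha, ← Module.End.mul_apply, ← map_mul, inv_mul_cancel, map_one]
        rfl }
  have hF : F ≠ ⊥ := fun hF => hne ((Subgroup.mem_bot).1 (hF ▸ (h : g ∈ F)))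
  have h1 : ρ (x ^ p) v = v := pow_mem_of_ne_one hp hG hC hx hF
  rw [map_pow] at h1
  exact pow_apply_ne hV hp hρ hv h1

/-- By irreducibility the stabilizer of a nonzero vector is the kernel, and the kernel contains `x ^
p` but not `x`. -/
theorem fixesExactly_of_orderOf_eq (hp : p.Prime) (hG : Nat.card G = p ^ 2) [IsCyclic G]
    (hC : Nat.card C = p) {x : G} (hx : orderOf x = p ^ 2) {ρ : Representation ℝ G V}
    (hρ : ρ.IsIrreducible) (hord : orderOf (ρ x) = p) :
    FixesExactly (ρ.comp (⊤ : Subgroup G).subtype) C := by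
  have hker : ρ.ker = C := by
    obtain h | h | h := eq_bot_or_eq_or_eq_top hp hG hC ρ.ker
    · have h1 : x ^ p ∈ ρ.ker := by rw [MonoidHom.mem_ker, map_pow, ← hord, pow_orderOf_eq_one]
      rw [h, Subgroup.mem_bot] at h1
      have := Nat.le_of_dvd hp.pos (hx ▸ orderOf_dvd_of_pow_eq_one h1)
      nlinarith [hp.two_le]
    · exact h
    · have h1 : x ∈ ρ.ker := h ▸ Subgroup.mem_top x
      rw [MonoidHom.mem_ker.1 h1, orderOf_one] at hord
      exact (hp.ne_one hord.symm).elim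
  rintro v hv ⟨g, hg⟩
  rw [← hker]
  exact apply_eq_self_iff hρ hv g

end CyclicGroup

/-- A nontrivial element of a group of prime order generates it, so if it fixed a nonzero vector the
whole irreducible representation would be trivial. -/
theorem fixesExactly_of_card_eq_prime {G : Type u} [CommGroup G] {p : ℕ} (hp : p.Prime)
    {C : Subgroup G} (hC : Nat.card C = p) {U : Type v} [AddCommGroup U] [Module ℝ U]
    {ρ : Representation ℝ C U} (hρ : ρ.IsIrreducible) (hne : ∃ c, ρ c ≠ 1) :
    FixesExactly ρ ⊥ := by
  have := Fact.mk (hC.symm ▸ hp)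
  intro v hv c
  rw [apply_eq_self_iff hρ hv, Subgroup.mem_bot, OneMemClass.coe_eq_one]
  refine ⟨fun h => ?_, fun h => by rw [h, map_one]⟩
  by_contra hc
  obtain ⟨d, hd⟩ := hne
  obtain ⟨k, rfl⟩ := mem_powers_of_prime_card rfl hc (g' := d)
  exact hd (by simp [h])

end EquivariantArity

theorem mainTheorem6 {G : Type*} [CommGroup G] [Finite G] (p : ℕ) (hp : p.Prime)
    (hG : Nat.card G = p ^ 2) (x : G) (hx : orderOf x = p ^ 2)
    (C : Subgroup G) (hC : Nat.card C = p) :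
    Nat.card {I : WeakIndexingSystem (⊤ : Subgroup G) // I.IsUnital} = 21 ∧
    ∃ φ : Vertex ≃ {I : WeakIndexingSystem (⊤ : Subgroup G) // I.IsUnital},
      (∀ a b, φ a ≤ φ b ↔ Relation.ReflTransGen (fun c d => (c, d) ∈ arrows) a b) ∧
      (∀ a b, φ a ⋖ φ b ↔ (a, b) ∈ arrows) ∧
      (∀ a (K H : Subgroup G) (h : K ≤ H),
        (φ a).1.mem H (orbit h) ↔ (a.transfer C).rel K H) ∧
      (∀ a (H : Subgroup G),
        (φ a).1.mem H ((FinAct.point H).sum (FinAct.point H)) ↔ H ∈ a.foldFamily C) ∧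
      ∀ (V W U : Type*) [AddCommGroup V] [Module ℝ V] [AddCommGroup W] [Module ℝ W]
        [AddCommGroup U] [Module ℝ U] (ρ₂ : Representation ℝ G V) (ρ₁ : Representation ℝ G W)
        (ρ₀ : Representation ℝ C U),
        Module.finrank ℝ V = 2 → orderOf (ρ₂ x) = p ^ 2 →
        ρ₁.IsIrreducible → orderOf (ρ₁ x) = p →
        ρ₀.IsIrreducible → (∃ c, ρ₀ c ≠ 1) →
        ∀ a, (φ a).1 = a.label C ρ₂ ρ₁ ρ₀ := by
  have : IsCyclic G := isCyclic_of_orderOf_eq_card x (hx.trans hG.symm)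
  obtain ⟨e, he⟩ := exists_subgroup_orderIso hp hG hC
  refine ⟨?_, (Vertex.systemIso e).toEquiv, fun a b => ?_, fun a b => ?_, fun a K H h => ?_,
    fun a H => ?_, ?_⟩
  · rw [← Nat.card_congr (Vertex.systemIso e).toEquiv, Nat.card_eq_fintype_card, Vertex.card]
  · exact (Vertex.systemIso e).le_iff_le.trans (Vertex.le_iff_reflTransGen a b)
  · exact (apply_covBy_apply_iff (Vertex.systemIso e)).trans (Vertex.covBy_iff a b)
  · exact (WeakIndexingSystem.orbit_mem_ofPattern (a.isPattern.comap e) h).trans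
      (transfer_rel_iff e he a K H).symm
  · exact (WeakIndexingSystem.two_points_mem_ofPattern (a.isPattern.comap e)).trans
      (mem_foldFamily_iff e he a H).symm
  -- The bijection was built from patterns alone, so the same one serves every choice of
  -- representations.
  · intro V W U _ _ _ _ _ _ ρ₂ ρ₁ ρ₀ hV h₂ hρ₁ h₁ hρ₀ h₀ a
    have : Nontrivial V := Module.nontrivial_of_finrank_pos (R := ℝ) (by omega)
    have : Nontrivial W := nontrivial_of_isIrreducible hρ₁
    have : Nontrivial U := nontrivial_of_isIrreducible hρ₀
    exact system_eq_label e he (fixesExactly_of_finrank_eq_two hp hG hC hx hV h₂)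
      (fixesExactly_of_orderOf_eq hp hG hC hx hρ₁ h₁) (fixesExactly_of_card_eq_prime hp hC hρ₀ h₀) a
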